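/- **Setting.** A *symmetric problem* $P$ on the vertex set $[n]=\{1,\dots,n\}$ consists of a family $E_P$ of subsets of $[n]$ (hyperedges), real variables $x_e$ ($e\in E_P$), and a set of polynomial equations $s=0$ in these variables, both invariant under permutations of $[n]$. For a monomial $p$ let $I(p)\subseteq[n]$ be the union of the hyperedges $e$ with $x_e$ occurring in $p$. For $I\subseteq[n]$, the index degree $\mathrm{indexdeg}_{[n]\setminus I}(f)$ of a polynomial $f$ is the maximum of $|I(p)\setminus I|$ over the monomials $p$ of $f$, and $\mathcal P_I$ is the space of polynomials in the variables $x_e$, $e\subseteq I$. For a sequence $A$ of distinct elements of $[n]$, $I_A$ is its set of entries; $A\subseteq B$ means that $A$ is an initial segment of $B$. A *level $n'$ story* $S$ for $(P,A)$, where $0\le n'\le n-|I_A|$, consists of a linear map $\tilde E_{S,A}:\mathcal P_{I_A}\to\mathbb R$ and, if $n'>0$, for each $i\in[n]\setminus I_A$, finitely many real numbers $p_{ij}$ with $\sum_j p_{ij}=1$ and level $n'-1$ stories $S_{ij}$ for $(P,A\cup(i))$ such that $\tilde E_{S_{ij},A\cup(i)}$ extends $\tilde E_{S,A}$. If $A\subseteq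 B$, $A \neq B$, and $B$ has at most $n'$ further entries, the first of which is $i$, put $\tilde E_{S,B}=\sum_j p_{ij}\tilde E_{S_{ij},B}$. $S$ is *self-consistent* if $\tilde E_{S,B}=\tilde E_{S,B'}$ on $\mathcal P_{I_B\cap I_{B'}}$ for all such $B,B'$; it then induces a linear map $\tilde E_S$ on $\{f:\mathrm{indexdeg}_{[n]\setminus I_A}(f)\le n'\}$, given on a monomial $p$ by $\tilde E_{S,B}[p]$ for any such $B$ with $I(p)\subseteq I_B$. $S$ is a *level $n'$ single graph mimic* for $(P,A)$ if it is a self-consistent level $n'$ story and, with degrees meaning $\mathrm{indexdeg}_{[n]\setminus I_A}$: (i) $\tilde E_S$ is invariant under permutations of $[n]\setminus I_A$; (ii) $\tilde E_S[fs]=0$ for every equation $s=0$ of $P$ and every $f$ with $\mathrm{indexdeg}(f)+\mathrm{indexdeg}(s)\le n'$; (iii) $\tilde E_S[fg]=\tilde E_S[f]\tilde E_S[g]$ for all $f,g$ symmetric under permutations of $[n]\setminus I_A$ with $\mathrm{indexdeg}(f)+\mathrm{indexdeg}(g)\le n'$. $S$ is a *level $(r,n')$ good story* for $(P,A)$ if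 it is a level $n'$ single graph mimic for $(P,A)$ and, if $r>0$, for all $i\in[n]\setminus I_A$ and all $j$, $p_{ij}\ge0$ and $S_{ij}$ is a level $(r-1,n'-1)$ good story for $(P,A\cup(i))$. A good story for $P$ is one for $(P,())$. **Problems.** *Knapsack* with real $k$: variables $x_1,\dots,x_n$, equations $x_i^2-x_i=0$ and $\sum_i x_i-k=0$. *MOD 2 principle*: variables $x_{ij}=x_{ji}$ ($i\ne j$), equations $x_{ij}^2-x_{ij}=0$ and $\sum_{j\ne i}x_{ij}-1=0$ for each $i$. *Triangle problem* with edge density $\rho$: variables $x_{ij}=x_{ji}$ ($i\neq j$), equations $x_{ij}^2-x_{ij}=0$, $\sum_{i<j}x_{ij}-\rho\binom n2=0$ and $\sum_{i<j<l}x_{ij}x_{il}x_{jl}-t(n,\rho)=0$, where $t(n,\rho)=\binom n3-\frac{n(n-1)(1-\rho)}6\big((1+2\rho)n-2-2\rho\big)$. **Stories.** In each of the following, $\tilde E_{S,A}$ evaluates polynomials at the 0/1 values of the variables inside $I_A$ determined so far; $m=|I_A|$, and the next queried index is $i$. * "Take $k$ of $n$ elements": if $a$ elements of $I_A$ have been taken,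 then $x_i=1$ with probability $\frac{k-a}{n-m}$ and $x_i=0$ with probability $\frac{n-k-(m-a)}{n-m}$. * "Each vertex is matched exactly once": if $u$ vertices of $I_A$ are not yet matched, then $i$ is matched to each of them with probability $\frac1{n-m}$, and to no vertex of $I_A$ with probability $\frac{n-m-u}{n-m}$; $x_{ij}=1$ if $i,j$ are matched, else $x_{ij}=0$. * "$k$ independent sets of size $n/k$": if $I_A$ has been partitioned into nonempty parts $B_1,\dots,B_t$, then $i$ joins $B_l$ with probability $\frac{n/k-|B_l|}{n-m}$ and starts a new part with probability $\frac{n-tn/k}{n-m}$; $x_{ij}=0$ if $i,j$ are in the same part, else $x_{ij}=1$. All listed outcomes are outcomes of the story, also when their probability happens to be $0$. **Theorem.** 1. Let $n\ge2$ be an integer and $k\in[0,n]$ real, with $(n,k)\ne(2,1)$. Then "take $k$ of $n$ elements" is a level $(\lfloor\min\{k,n-k\}\rfloor+1,\,n)$ good story for knapsack. 2. Let $n\ge5$ be an integer. Then "each vertex is matched exactly once" is a level $(\lfloor n/2\rfloor+1,\,n)$ good story for the MOD 2 principle. 3. Let $n\ge6$ be an integer, $k\in[1,n]$ real, and let $\rho$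 be given by $\frac nk-1=(1-\rho)(n-1)$. Then "$k$ independent sets of size $n/k$" is a level $(\lfloor\min\{k,n/k\}\rfloor+1,\,n)$ good story for the triangle problem. -/

import Mathlib

open MvPolynomial

/-- A symmetric hypergraph problem on the vertex set `Fin n` with unordered hyperedges: a set of
possible hyperedges `E_P`, and a set of polynomial equations `s = 0` (given by the polynomials `s`)
in the real variables `x_e`, `e ∈ E_P`; both sets are invariant under permutations of `Fin n`. -/
structure SymmetricProblem (n : ℕ) where
  edges : Finset (Finset (Fin n))
  map_mem_edges : ∀ (σ : Equiv.Perm (Fin n)) (e : Finset (Fin n)),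
    e ∈ edges → e.map σ.toEmbedding ∈ edges
  eqs : Set (MvPolynomial edges ℝ)
  rename_mem_eqs : ∀ (σ : Equiv.Perm (Fin n)), ∀ s ∈ eqs,
    rename (fun e : edges => (⟨e.1.map σ.toEmbedding, map_mem_edges σ e.1 e.2⟩ : edges)) s ∈ eqs

namespace SymmetricProblem

variable {n : ℕ} (P : SymmetricProblem n)

/-- Polynomials in the variables `x_e`, `e ∈ E_P`. -/
abbrev Poly : Type := MvPolynomial P.edges ℝ

/-- The action of a permutation of the vertices on hyperedges. -/
def permEdge (σ : Equiv.Perm (Fin n)) (e : P.edges) : P.edges :=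
  ⟨e.1.map σ.toEmbedding, P.map_mem_edges σ e.1 e.2⟩

/-- The action of a permutation of the vertices on polynomials, `x_e ↦ x_{σ(e)}`. -/
noncomputable def permPoly (σ : Equiv.Perm (Fin n)) (f : P.Poly) : P.Poly :=
  rename (P.permEdge σ) f

/-- `f` is symmetric under the permutations of `[n] \ I`. -/
def IsSymmetricOutside (I : Finset (Fin n)) (f : P.Poly) : Prop :=
  ∀ σ : Equiv.Perm (Fin n), (∀ a ∈ I, σ a = a) → P.permPoly σ f = f

/-- The set `I(p)` of indices which a monomial `p` depends on. -/
def indices (m : P.edges →₀ ℕ) : Finset (Fin n) :=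
  m.support.biUnion fun e => e.1

/-- The index degree of a polynomial on `[n] \ I`: the maximum of `|I(p) \ I|` over its
monomials `p`. -/
def indexDeg (I : Finset (Fin n)) (f : P.Poly) : ℕ :=
  f.support.sup fun m => (P.indices m \ I).card

lemma indices_add (m m' : P.edges →₀ ℕ) :
    P.indices (m + m') = P.indices m ∪ P.indices m' := by
  classical
  ext v
  simp only [indices, Finset.mem_biUnion, Finset.mem_union, Finsupp.mem_support_iff,
    Finsupp.add_apply, ne_eq, Nat.add_eq_zero_iff, not_and_or]
  constructor
  · rintro ⟨e, h | h, hv⟩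
    · exact Or.inl ⟨e, h, hv⟩
    · exact Or.inr ⟨e, h, hv⟩
  · rintro (⟨e, h, hv⟩ | ⟨e, h, hv⟩)
    · exact ⟨e, Or.inl h, hv⟩
    · exact ⟨e, Or.inr h, hv⟩

lemma indexDeg_le_iff {I : Finset (Fin n)} {f : P.Poly} {d : ℕ} :
    P.indexDeg I f ≤ d ↔ ∀ m ∈ f.support, (P.indices m \ I).card ≤ d := by
  simp [indexDeg, Finset.sup_le_iff]

lemma indexDeg_mul_le (I : Finset (Fin n)) (f g : P.Poly) :
    P.indexDeg I (f * g) ≤ P.indexDeg I f + P.indexDeg I g := by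
  classical
  rw [indexDeg_le_iff]
  intro m hm
  obtain ⟨a, ha, b, hb, rfl⟩ := Finset.mem_add.1 (support_mul f g hm)
  rw [indices_add, Finset.union_sdiff_distrib]
  refine (Finset.card_union_le _ _).trans (Nat.add_le_add ?_ ?_)
  · exact P.indexDeg_le_iff.1 le_rfl a ha
  · exact P.indexDeg_le_iff.1 le_rfl b hb

/-- The space of polynomials of index degree at most `d` on `[n] \ I`. -/
def lowIndexDeg (I : Finset (Fin n)) (d : ℕ) : Submodule ℝ P.Poly where
  carrier := {f | P.indexDeg I f ≤ d}
  zero_mem' := by simp [indexDeg]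
  add_mem' := by
    classical
    intro f g hf hg
    simp only [Set.mem_ofPred_eq, indexDeg_le_iff] at hf hg ⊢
    intro m hm
    rcases Finset.mem_union.1 (support_add hm) with h | h
    · exact hf m h
    · exact hg m h
  smul_mem' := by
    intro c f hf
    simp only [Set.mem_ofPred_eq, indexDeg_le_iff] at hf ⊢
    exact fun m hm => hf m (support_smul hm)

lemma mul_mem_lowIndexDeg {I : Finset (Fin n)} {d : ℕ} {f g : P.Poly}
    (h : P.indexDeg I f + P.indexDeg I g ≤ d) : f * g ∈ P.lowIndexDeg I d :=
  (P.indexDeg_mul_le I f g).trans h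

lemma left_mem_lowIndexDeg {I : Finset (Fin n)} {d : ℕ} {f g : P.Poly}
    (h : P.indexDeg I f + P.indexDeg I g ≤ d) : f ∈ P.lowIndexDeg I d :=
  (Nat.le_add_right _ _).trans h

lemma right_mem_lowIndexDeg {I : Finset (Fin n)} {d : ℕ} {f g : P.Poly}
    (h : P.indexDeg I f + P.indexDeg I g ≤ d) : g ∈ P.lowIndexDeg I d :=
  (Nat.le_add_left _ _).trans h

lemma indices_mapDomain (σ : Equiv.Perm (Fin n)) (m : P.edges →₀ ℕ) :
    P.indices (m.mapDomain (P.permEdge σ)) = (P.indices m).map σ.toEmbedding := by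
  classical
  have hinj : Function.Injective (P.permEdge σ) := fun e e' h =>
    Subtype.ext (Finset.map_injective _ (congrArg Subtype.val h))
  ext v
  simp only [indices, Finsupp.mapDomain_support_of_injective hinj, Finset.mem_biUnion,
    Finset.mem_image, Finset.mem_map]
  constructor
  · rintro ⟨_, ⟨e, he, rfl⟩, hv⟩
    obtain ⟨w, hw, rfl⟩ := Finset.mem_map.1 hv
    exact ⟨w, ⟨e, he, hw⟩, rfl⟩
  · rintro ⟨w, ⟨e, he, hw⟩, rfl⟩
    exact ⟨_, ⟨e, he, rfl⟩, Finset.mem_map.2 ⟨w, hw, rfl⟩⟩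

lemma permPoly_mem_lowIndexDeg {I : Finset (Fin n)} {d : ℕ} {f : P.Poly}
    {σ : Equiv.Perm (Fin n)} (hσ : ∀ a ∈ I, σ a = a) (hf : f ∈ P.lowIndexDeg I d) :
    P.permPoly σ f ∈ P.lowIndexDeg I d := by
  classical
  have hf' := P.indexDeg_le_iff.1 (show P.indexDeg I f ≤ d from hf)
  refine P.indexDeg_le_iff.2 fun m hm => ?_
  have hinj : Function.Injective (P.permEdge σ) := fun e e' h =>
    Subtype.ext (Finset.map_injective _ (congrArg Subtype.val h))
  rw [permPoly, support_rename_of_injective hinj] at hm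
  obtain ⟨m', hm', rfl⟩ := Finset.mem_image.1 hm
  have hI : I = I.map σ.toEmbedding := by
    refine (Finset.eq_of_subset_of_card_le (fun a ha => ?_) (by simp))
    exact Finset.mem_map.2 ⟨a, ha, hσ a ha⟩
  rw [indices_mapDomain, hI, ← Finset.map_sdiff, Finset.card_map]
  exact hf' m' hm'

/-- The space `𝒫_I` of polynomials which only depend on the variables `x_e` with `e ⊆ I`. -/
noncomputable def polysOn (I : Finset (Fin n)) : Submodule ℝ P.Poly :=
  Subalgebra.toSubmodule (supported ℝ {e : P.edges | e.1 ⊆ I})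

lemma polysOn_mono {I J : Finset (Fin n)} (h : I ⊆ J) : P.polysOn I ≤ P.polysOn J :=
  supported_mono fun _ he => Finset.Subset.trans he h

/-- A linear map `E` on the polynomials of index degree at most `d` on `[n] \ I` is a level `d`
single graph mimic for `P` on `[n] \ I`. -/
structure IsSingleGraphMimic (I : Finset (Fin n)) (d : ℕ)
    (E : P.lowIndexDeg I d →ₗ[ℝ] ℝ) : Prop where
  symmetric : ∀ (σ : Equiv.Perm (Fin n)) (hσ : ∀ a ∈ I, σ a = a) (f : P.Poly)
    (hf : f ∈ P.lowIndexDeg I d),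
    E ⟨P.permPoly σ f, P.permPoly_mem_lowIndexDeg hσ hf⟩ = E ⟨f, hf⟩
  equations : ∀ s ∈ P.eqs, ∀ (f : P.Poly) (h : P.indexDeg I f + P.indexDeg I s ≤ d),
    E ⟨f * s, P.mul_mem_lowIndexDeg h⟩ = 0
  multiplicative : ∀ f g : P.Poly, P.IsSymmetricOutside I f → P.IsSymmetricOutside I g →
    ∀ h : P.indexDeg I f + P.indexDeg I g ≤ d,
    E ⟨f * g, P.mul_mem_lowIndexDeg h⟩ =
      E ⟨f, P.left_mem_lowIndexDeg h⟩ * E ⟨g, P.right_mem_lowIndexDeg h⟩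

/-- A strategy of the adversary for at most `d` further queries, after the sequence `A` has been
queried. At each stage it gives a linear map on `𝒫_{I_A}`; if a further query is allowed, then for
each index `i` not yet queried it gives a finite set of outcomes `j`, a real number `p i j` (the
"probability" of the outcome), and a strategy for how to continue after the outcome `j`. -/
inductive Strategy : List (Fin n) → ℕ → Type 1 where
  | leaf (A : List (Fin n)) (E : P.polysOn A.toFinset →ₗ[ℝ] ℝ) : Strategy A 0
  | node (A : List (Fin n)) (d : ℕ) (E : P.polysOn A.toFinset →ₗ[ℝ] ℝ)
      (outcome : ∀ i : Fin n, i ∉ A → Type)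
      (fin : ∀ (i : Fin n) (hi : i ∉ A), Fintype (outcome i hi))
      (p : ∀ (i : Fin n) (hi : i ∉ A), outcome i hi → ℝ)
      (next : ∀ (i : Fin n) (hi : i ∉ A), outcome i hi → Strategy (A ++ [i]) d) :
      Strategy A (d + 1)

namespace Strategy

variable {P}

/-- The linear map `Ẽ_{S,A}` on `𝒫_{I_A}` describing what happened with the indices in `A`. -/
def base {A : List (Fin n)} {d : ℕ} : P.Strategy A d → (P.polysOn A.toFinset →ₗ[ℝ] ℝ)
  | leaf _ E => E
  | node _ _ E _ _ _ _ => E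

/-- `S` is a level `d` story for `(P, A)`. -/
def IsStory {A : List (Fin n)} {d : ℕ} : P.Strategy A d → Prop
  | leaf A _ => A.Nodup
  | node A d E outcome fin p next =>
      A.Nodup ∧ d + 1 ≤ n - A.length ∧
      ∀ (i : Fin n) (hi : i ∉ A),
        (letI := fin i hi
         ∑ j, p i hi j = 1) ∧
        ∀ j : outcome i hi,
          (∀ (f : P.Poly) (hf : f ∈ P.polysOn A.toFinset),
            E ⟨f, hf⟩ =
              (next i hi j).base ⟨f, P.polysOn_mono (by intro; simp; tauto) hf⟩) ∧
          (next i hi j).IsStory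

/-- The value `Ẽ_{S,B}[f]`, `f ∈ 𝒫_{I_B}`, where `B` is `A` followed by the sequence `L`. It is only
used if the indices in `B` are distinct and `L` has length at most `d`; otherwise the value is
irrelevant. -/
noncomputable def expect {A : List (Fin n)} {d : ℕ} (S : P.Strategy A d) (L : List (Fin n))
    (f : P.Poly) (hf : f ∈ P.polysOn (A ++ L).toFinset) : ℝ :=
  match d, S, L, hf with
  | _, S, [], hf => S.base ⟨f, by simpa using hf⟩
  | _, leaf _ _, _ :: _, _ => 0
  | _, node A _ _ _ fin p next, i :: L, hf =>
      if hi : i ∉ A then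
        letI := fin i hi
        ∑ j, p i hi j * (next i hi j).expect L f (by simpa using hf)
      else 0

/-- The sequence `A` followed by `L` is a sequence of distinct indices which queries at most `d`
indices beyond `A`. -/
def IsQuery (A : List (Fin n)) (d : ℕ) (L : List (Fin n)) : Prop :=
  (A ++ L).Nodup ∧ L.length ≤ d

/-- `S` is self-consistent: `Ẽ_{S,B}` and `Ẽ_{S,B'}` agree on `𝒫_{I_B} ∩ 𝒫_{I_{B'}}`, which is
`𝒫_{I_B ∩ I_{B'}}`. -/
def IsSelfConsistent {A : List (Fin n)} {d : ℕ} (S : P.Strategy A d) : Prop :=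
  ∀ L L' : List (Fin n), IsQuery A d L → IsQuery A d L' →
    ∀ (f : P.Poly) (hf : f ∈ P.polysOn (A ++ L).toFinset)
      (hf' : f ∈ P.polysOn (A ++ L').toFinset),
      S.expect L f hf = S.expect L' f hf'

/-- `E` is the linear map `Ẽ_S` on the polynomials of index degree at most `d` on `[n] \ I_A` which
is induced by `S`: for a monomial `m`, the value of `E` is `Ẽ_{S,B}[m]` whenever `B` is obtained
from `A` by querying at most `d` further indices and contains all indices of `m`. -/
def Induces {A : List (Fin n)} {d : ℕ} (S : P.Strategy A d)
    (E : P.lowIndexDeg A.toFinset d →ₗ[ℝ] ℝ) : Prop :=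
  ∀ (m : P.edges →₀ ℕ) (hm : monomial m (1 : ℝ) ∈ P.lowIndexDeg A.toFinset d)
    (L : List (Fin n)), IsQuery A d L →
    ∀ hL : monomial m (1 : ℝ) ∈ P.polysOn (A ++ L).toFinset,
      E ⟨monomial m 1, hm⟩ = S.expect L (monomial m 1) hL

/-- `S` is a level `d` single graph mimic for `(P, A)`: it is a self-consistent level `d` story and
`Ẽ_S` is a level `d` single graph mimic for `P` on `[n] \ I_A`. -/
def IsMimic {A : List (Fin n)} {d : ℕ} (S : P.Strategy A d) : Prop :=
  S.IsStory ∧ S.IsSelfConsistent ∧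
    ∃ E : P.lowIndexDeg A.toFinset d →ₗ[ℝ] ℝ,
      S.Induces E ∧ P.IsSingleGraphMimic A.toFinset d E

/-- `S` is a level `(r, d)` good story for `(P, A)`. -/
def IsGoodStory {A : List (Fin n)} (r d : ℕ) (S : P.Strategy A d) : Prop :=
  match r, d, S with
  | 0, _, S => S.IsMimic
  | _ + 1, _, leaf A E => (leaf A E).IsMimic
  | r + 1, _, node A d E outcome fin p next =>
      (node A d E outcome fin p next).IsMimic ∧
      ∀ (i : Fin n) (hi : i ∉ A) (j : outcome i hi),
        0 ≤ p i hi j ∧ IsGoodStory r d (next i hi j)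

end Strategy

/-- Evaluation at the input `x`, as a linear map on `𝒫_I`; it depends only on the `x e`
with `e ⊆ I`. -/
noncomputable def evalOn (I : Finset (Fin n)) (x : P.edges → ℝ) : P.polysOn I →ₗ[ℝ] ℝ :=
  (aeval x).toLinearMap ∘ₗ (P.polysOn I).subtype

end SymmetricProblem

/-- The possible hyperedges of a problem of arity `t`: all subsets of `[n]` of size `t`. -/
abbrev tSubsets (n t : ℕ) : Finset (Finset (Fin n)) := Finset.powersetCard t Finset.univ

lemma map_mem_tSubsets {n t : ℕ} (σ : Equiv.Perm (Fin n)) (e : Finset (Fin n))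
    (he : e ∈ tSubsets n t) : e.map σ.toEmbedding ∈ tSubsets n t := by
  simpa [Finset.mem_powersetCard] using he

/-- A permutation of the vertices as a permutation of the hyperedges. -/
def permSubsets {n t : ℕ} (σ : Equiv.Perm (Fin n)) : Equiv.Perm (tSubsets n t) where
  toFun e := ⟨e.1.map σ.toEmbedding, map_mem_tSubsets σ e.1 e.2⟩
  invFun e := ⟨e.1.map σ.symm.toEmbedding, map_mem_tSubsets σ.symm e.1 e.2⟩
  left_inv e := Subtype.ext (by ext; simp)
  right_inv e := Subtype.ext (by ext; simp)

/-- Knapsack with unit weights and capacity `k`: `x_i ^ 2 - x_i = 0` for all `i`, and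
`∑ x_i - k = 0`. The variable `x_i` is indexed by the one-element set `{i}`. -/
noncomputable def knapsack (n : ℕ) (k : ℝ) : SymmetricProblem n where
  edges := tSubsets n 1
  map_mem_edges := map_mem_tSubsets
  eqs := {s | (∃ e, s = X e ^ 2 - X e) ∨ s = ∑ e, X e - C k}
  rename_mem_eqs := by
    rintro σ s (⟨e, rfl⟩ | rfl)
    · exact Or.inl ⟨permSubsets σ e, by simp [permSubsets]⟩
    · refine Or.inr ?_
      simp only [map_sub, map_sum, rename_X, rename_C]
      congr 1
      exact Equiv.sum_comp (permSubsets σ) (fun e => (X e : MvPolynomial (tSubsets n 1) ℝ))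

/-- The MOD 2 principle: `x_e ^ 2 - x_e = 0` for all pairs `e`, and `∑_{e ∋ i} x_e - 1 = 0` for
every vertex `i`. -/
noncomputable def modTwo (n : ℕ) : SymmetricProblem n where
  edges := tSubsets n 2
  map_mem_edges := map_mem_tSubsets
  eqs := {s | (∃ e, s = X e ^ 2 - X e) ∨
    ∃ i : Fin n, s = ∑ e with i ∈ e.1, X e - 1}
  rename_mem_eqs := by
    rintro σ s (⟨e, rfl⟩ | ⟨i, rfl⟩)
    · exact Or.inl ⟨permSubsets σ e, by simp [permSubsets]⟩
    · refine Or.inr ⟨σ i, ?_⟩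
      simp only [map_sub, map_sum, rename_X, map_one]
      congr 1
      refine Finset.sum_equiv (permSubsets σ) (fun e => ?_) (fun e _ => rfl)
      simp [permSubsets]

/-- Goodman's lower bound `t(n, ρ)` on the number of triangles of a graph with `n` vertices and
edge density `ρ`. -/
noncomputable def goodmanBound (n : ℕ) (ρ : ℝ) : ℝ :=
  (n.choose 3 : ℝ) - (n : ℝ) * ((n : ℝ) - 1) * (1 - ρ) / 6 * ((1 + 2 * ρ) * n - 2 - 2 * ρ)

/-- The triangle problem for edge density `ρ`: `x_e ^ 2 - x_e = 0` for all pairs `e`,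
`∑ x_e - ρ (n choose 2) = 0`, and the number of triangles equals Goodman's bound `t(n, ρ)`. -/
noncomputable def triangleProblem (n : ℕ) (ρ : ℝ) : SymmetricProblem n where
  edges := tSubsets n 2
  map_mem_edges := map_mem_tSubsets
  eqs := {s | (∃ e, s = X e ^ 2 - X e) ∨
    s = ∑ e, X e - C (ρ * (n.choose 2 : ℝ)) ∨
    s = ∑ T ∈ tSubsets n 3, ∏ e with e.1 ⊆ T, X e - C (goodmanBound n ρ)}
  rename_mem_eqs := by
    rintro σ s (⟨e, rfl⟩ | rfl | rfl)
    · exact Or.inl ⟨permSubsets σ e, by simp [permSubsets]⟩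
    · refine Or.inr (Or.inl ?_)
      simp only [map_sub, map_sum, rename_X, rename_C]
      congr 1
      exact Equiv.sum_comp (permSubsets σ) (fun e => (X e : MvPolynomial (tSubsets n 2) ℝ))
    · refine Or.inr (Or.inr ?_)
      simp only [map_sub, map_sum, map_prod, rename_X, rename_C]
      congr 1
      refine Finset.sum_bij (fun T _ => T.map σ.toEmbedding)
        (fun T hT => map_mem_tSubsets σ T hT) (fun T _ T' _ h => Finset.map_injective _ h)
        (fun T hT => ⟨T.map σ.symm.toEmbedding, map_mem_tSubsets σ.symm T hT, by ext; simp⟩)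
        (fun T _ => ?_)
      refine Finset.prod_equiv (permSubsets σ) (fun e => ?_) (fun e _ => rfl)
      simp [permSubsets]

open SymmetricProblem

/-- The story "take `k` of the `n` elements", continued for `d` further queries after the sequence
`A` has been queried and the elements of `T` (a subset of `A`) have been taken. The next element
is taken with probability `(k - |T|) / (n - |A|)`, and left with probability
`(n - k - (|A| - |T|)) / (n - |A|)`. -/
noncomputable def knapsackStoryFrom (n : ℕ) (k : ℝ) : (d : ℕ) → (A : List (Fin n)) →
    (T : Finset (Fin n)) → (knapsack n k).Strategy A d
  | 0, A, T => .leaf A ((knapsack n k).evalOn A.toFinset fun e => if e.1 ⊆ T then 1 else 0)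
  | d + 1, A, T =>
      .node A d ((knapsack n k).evalOn A.toFinset fun e => if e.1 ⊆ T then 1 else 0)
        (fun _ _ => Bool) (fun _ _ => inferInstance)
        (fun _ _ taken =>
          if taken then (k - T.card) / ((n : ℝ) - A.length)
          else ((n : ℝ) - k - ((A.length : ℝ) - T.card)) / ((n : ℝ) - A.length))
        (fun i _ taken =>
          knapsackStoryFrom n k d (A ++ [i]) (if taken then insert i T else T))

/-- The story "take `k` of the `n` elements". -/
noncomputable def knapsackStory (n : ℕ) (k : ℝ) : (knapsack n k).Strategy [] n :=
  knapsackStoryFrom n k n [] ∅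

/-- The vertices in `A` which are in no edge of `M`. -/
def unmatched {n : ℕ} (A : List (Fin n)) (M : Finset (Finset (Fin n))) : Finset (Fin n) :=
  A.toFinset.filter fun v => ∀ e ∈ M, v ∉ e

/-- The story "each vertex is matched exactly once", continued for `d` further queries after the
sequence `A` has been queried and `M` is the set of matched pairs inside `A`. The next vertex is
matched to each vertex of `A` which is still unmatched with probability `1 / (n - |A|)`, and to no
vertex of `A` with the remaining probability. -/
noncomputable def modTwoStoryFrom (n : ℕ) : (d : ℕ) → (A : List (Fin n)) →
    (M : Finset (Finset (Fin n))) → (modTwo n).Strategy A d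
  | 0, A, M => .leaf A ((modTwo n).evalOn A.toFinset fun e => if e.1 ∈ M then 1 else 0)
  | d + 1, A, M =>
      .node A d ((modTwo n).evalOn A.toFinset fun e => if e.1 ∈ M then 1 else 0)
        (fun _ _ => Option (unmatched A M)) (fun _ _ => inferInstance)
        (fun _ _ o => match o with
          | some _ => 1 / ((n : ℝ) - A.length)
          | none => ((n : ℝ) - A.length - (unmatched A M).card) / ((n : ℝ) - A.length))
        (fun i _ o => match o with
          | some v => modTwoStoryFrom n d (A ++ [i]) (insert {v.1, i} M)
          | none => modTwoStoryFrom n d (A ++ [i]) M)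

/-- The story "each vertex is matched exactly once". -/
noncomputable def modTwoStory (n : ℕ) : (modTwo n).Strategy [] n :=
  modTwoStoryFrom n n [] ∅

/-- The story "`k` independent sets of size `n / k`, with all edges between different sets",
continued for `d` further queries after the sequence `A` has been queried; `F` is the set of the
nonempty traces on `A` of the independent sets, a partition of `A`. The next vertex belongs to the
independent set of `B ∈ F` with probability `(n / k - |B|) / (n - |A|)`, and to a new one with
probability `(n - |F| (n / k)) / (n - |A|)`. -/
noncomputable def triangleStoryFrom (n : ℕ) (k ρ : ℝ) : (d : ℕ) → (A : List (Fin n)) →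
    (F : Finset (Finset (Fin n))) → (triangleProblem n ρ).Strategy A d
  | 0, A, F => .leaf A ((triangleProblem n ρ).evalOn A.toFinset
      fun e => if ∃ B ∈ F, e.1 ⊆ B then 0 else 1)
  | d + 1, A, F =>
      .node A d ((triangleProblem n ρ).evalOn A.toFinset
          fun e => if ∃ B ∈ F, e.1 ⊆ B then 0 else 1)
        (fun _ _ => Option F) (fun _ _ => inferInstance)
        (fun _ _ o => match o with
          | some B => ((n : ℝ) / k - B.1.card) / ((n : ℝ) - A.length)
          | none => ((n : ℝ) - F.card * ((n : ℝ) / k)) / ((n : ℝ) - A.length))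
        (fun i _ o => match o with
          | some B => triangleStoryFrom n k ρ d (A ++ [i]) (insert (insert i B.1) (F.erase B.1))
          | none => triangleStoryFrom n k ρ d (A ++ [i]) (insert {i} F))

/-- The story "`k` independent sets of size `n / k`, with all edges between different sets". -/
noncomputable def triangleStory (n : ℕ) (k ρ : ℝ) : (triangleProblem n ρ).Strategy [] n :=
  triangleStoryFrom n k ρ n [] ∅

/-! All three stories are draws without replacement with possibly negative weights. Three laws carry
the argument: the weights of the outcomes add up to the number `n - |A|` of unrevealed vertices; two
vertices can be revealed in either order; and giving an outcome to one vertex lowers its weight by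
one for the others (`step_remove`). They are algebraic identities in the parameters, so they hold
even when no set, matching or partition of the required kind exists.

Since order does not matter, revealing all remaining vertices defines a functional `ev` that every
query sequence computes. This gives self-consistency, and relabelling the vertices gives symmetry.
The third law gives `sum_ev_swap`: once `i` has received an outcome, averaging over the unrevealed
vertices that could play the role of `i` recovers the expectation before `i` was revealed. For a
symmetric polynomial all terms of this average coincide, so revealing a vertex does not change its
expectation (`ev_next`): it behaves like a constant of one fixed graph.

Multiplicativity follows. To evaluate `f * g` with `g` symmetric, reveal the vertices of a monomial
of `f`; it becomes a number, while the expectation of `g` stays put. The degree bound guarantees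
that enough vertices remain for `ev_next`. In the same way `f * s` has expectation zero as soon as
`s` has in every state with enough unrevealed vertices. The Boolean equations hold in each state.
The other equations of knapsack and of the triangle problem are fully symmetric, so one computation
in the initial state suffices (`ev_eq_init`). The vertex equations of MOD 2 are not, and are
computed in each state.

A good story also needs nonnegative probabilities in the first queries, which bounds their number
`R`. The lower bounds on `n` ensure that after `R` queries enough vertices are left for the
equations. -/

/-! ### Processes without replacement and their laws -/

/-- A process which reveals a random structure on `Fin n` vertex by vertex: when the set `A` has
been revealed and the state is `T`, each outcome `o` of the next vertex has probability
`weight A T o / (n - |A|)`, which may be negative. The state determines the values `val` of the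
variables of `P` on the revealed vertices. -/
structure QueryProcess {n : ℕ} (P : SymmetricProblem n) (St O : Type) where
  outcomes : Finset (Fin n) → St → Finset O
  weight : Finset (Fin n) → St → O → ℝ
  next : St → Fin n → O → St
  init : St
  act : Equiv.Perm (Fin n) → St → St
  val : St → P.edges → ℝ

namespace QueryProcess

variable {n : ℕ} {P : SymmetricProblem n} {St O : Type} (Q : QueryProcess P St O)

/-- The states which can be reached after revealing a given set of vertices. -/
inductive Reach : Finset (Fin n) → St → Prop
  | init : Reach ∅ Q.init
  | step {A : Finset (Fin n)} {T : St} {i : Fin n} {o : O} :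
      Reach A T → i ∉ A → o ∈ Q.outcomes A T → Reach (insert i A) (Q.next T i o)

/-- The weighted sum of `φ` over the states after revealing `i`. -/
noncomputable def step (A : Finset (Fin n)) (T : St) (i : Fin n) (φ : St → ℝ) : ℝ :=
  ∑ o ∈ Q.outcomes A T, Q.weight A T o * φ (Q.next T i o)

/-- The laws of an exchangeable process without replacement: revealing an outcome lowers its weight
by one. -/
structure Laws : Prop where
  sum_weight : ∀ {A T}, Q.Reach A T → ∑ o ∈ Q.outcomes A T, Q.weight A T o = (n : ℝ) - A.card
  step_comm : ∀ {A T}, Q.Reach A T → ∀ {i j}, i ∉ A → j ∉ A → i ≠ j → ∀ φ : St → ℝ,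
    Q.step A T i (fun T' => Q.step (insert i A) T' j φ) =
      Q.step A T j (fun T' => Q.step (insert j A) T' i φ)
  -- Here `ψ` evaluates `φ` while forgetting the outcome of `i`. Forgetting is needed because
  -- revealing `i` may split outcomes of `j`: "new" becomes "together with `i`" or "new". After the
  -- identification, the only loss is one unit of the weight of `o`.
  step_remove : ∀ {A T}, Q.Reach A T → ∀ {i j}, i ∉ A → j ∉ A → i ≠ j →
    ∀ {o}, o ∈ Q.outcomes A T → ∀ φ ψ : St → ℝ,
    (∀ o₁ ∈ Q.outcomes A T, ∀ o₂ ∈ Q.outcomes (insert j A) (Q.next T j o₁),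
      ψ (Q.next (Q.next T j o₁) i o₂) = φ (Q.next T j o₁)) →
    Q.step (insert i A) (Q.next T i o) j ψ + φ (Q.next T j o) = Q.step A T j φ
  step_act : ∀ {A T}, Q.Reach A T → ∀ {i}, i ∉ A → ∀ (σ : Equiv.Perm (Fin n)) (φ : St → ℝ),
    Q.step (A.map σ.toEmbedding) (Q.act σ T) (σ i) φ = Q.step A T i (fun T' => φ (Q.act σ T'))
  act_init : ∀ σ, Q.act σ Q.init = Q.init
  act_next : ∀ {A T}, Q.Reach A T → ∀ {i}, i ∉ A → ∀ {o}, o ∈ Q.outcomes A T →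
    ∀ σ : Equiv.Perm (Fin n), (∀ a ∈ A, σ a = a) → Q.act σ (Q.next T i o) = Q.next T (σ i) o
  val_next : ∀ {A T}, Q.Reach A T → ∀ {i}, i ∉ A → ∀ {o}, o ∈ Q.outcomes A T →
    ∀ e : P.edges, e.1 ⊆ A → Q.val (Q.next T i o) e = Q.val T e
  val_act : ∀ σ T e, Q.val (Q.act σ T) (P.permEdge σ e) = Q.val T e

variable {Q}

lemma step_congr {A : Finset (Fin n)} {T : St} {i : Fin n} {φ ψ : St → ℝ}
    (h : ∀ o ∈ Q.outcomes A T, φ (Q.next T i o) = ψ (Q.next T i o)) :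
    Q.step A T i φ = Q.step A T i ψ :=
  Finset.sum_congr rfl fun o ho => by rw [h o ho]

lemma step_add (A : Finset (Fin n)) (T : St) (i : Fin n) (φ ψ : St → ℝ) :
    Q.step A T i (fun T' => φ T' + ψ T') = Q.step A T i φ + Q.step A T i ψ := by
  simp only [step, mul_add, Finset.sum_add_distrib]

lemma step_mul (A : Finset (Fin n)) (T : St) (i : Fin n) (φ : St → ℝ) (c : ℝ) :
    Q.step A T i (fun T' => c * φ T') = c * Q.step A T i φ := by
  simp only [step, Finset.mul_sum]
  exact Finset.sum_congr rfl fun o _ => by ring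

lemma step_div (A : Finset (Fin n)) (T : St) (i : Fin n) (φ : St → ℝ) (c : ℝ) :
    Q.step A T i (fun T' => φ T' / c) = Q.step A T i φ / c := by
  simp only [div_eq_inv_mul, step_mul]

lemma step_sum {ι : Type*} (s : Finset ι) (A : Finset (Fin n)) (T : St) (i : Fin n)
    (φ : ι → St → ℝ) :
    Q.step A T i (fun T' => ∑ v ∈ s, φ v T') = ∑ v ∈ s, Q.step A T i (φ v) := by
  simp only [step, Finset.mul_sum]
  exact Finset.sum_comm

lemma cast_sub_card_ne_zero {A : Finset (Fin n)} {i : Fin n} (hi : i ∉ A) :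
    (n : ℝ) - A.card ≠ 0 := by
  have h : A.card < n := by
    simpa using Finset.card_lt_univ_of_notMem hi
  have : (A.card : ℝ) < n := by exact_mod_cast h
  linarith

lemma Laws.step_const (hQ : Q.Laws) {A : Finset (Fin n)} {T : St} (hT : Q.Reach A T)
    {i : Fin n} (c : ℝ) : Q.step A T i (fun _ => c) = ((n : ℝ) - A.card) * c := by
  rw [← hQ.sum_weight hT, step, Finset.sum_mul]

/-! ### The expectation and its independence of the order of revealing -/

variable (Q) in
/-- The expectation of `φ` after revealing the vertices of a list. -/
noncomputable def listExp : List (Fin n) → Finset (Fin n) → St → (St → ℝ) → ℝ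
  | [], _, T, φ => φ T
  | i :: L, A, T, φ =>
      Q.step A T i (fun T' => listExp L (insert i A) T' φ) / ((n : ℝ) - A.card)

/-- Adjacent transpositions generate all reorderings, and for these the claim is `step_comm`; the
two denominators are the same in both orders. -/
lemma Laws.listExp_perm (hQ : Q.Laws) (φ : St → ℝ) {L L' : List (Fin n)} (h : L.Perm L') :
    ∀ {A : Finset (Fin n)} {T : St}, Q.Reach A T → L.Nodup → (∀ a ∈ L, a ∉ A) →
      Q.listExp L A T φ = Q.listExp L' A T φ := by
  induction h with
  | nil => intros; rfl
  | cons i _ ih =>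
    intro A T hT hn hA
    simp only [listExp]
    congr 1
    refine step_congr fun o ho => ?_
    have hi : i ∉ A := hA i (by simp)
    rw [List.nodup_cons] at hn
    refine ih (hT.step hi ho) hn.2 fun a ha => ?_
    rw [Finset.mem_insert, not_or]
    exact ⟨fun h => hn.1 (h ▸ ha), hA a (by simp [ha])⟩
  | swap i j L =>
    intro A T hT hn hA
    have hi : i ∉ A := hA i (by simp)
    have hj : j ∉ A := hA j (by simp)
    have hij : i ≠ j := by
      rintro rfl
      simp at hn
    simp only [listExp, step_div, Finset.card_insert_of_notMem hi, Finset.card_insert_of_notMem hj]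
    rw [Finset.insert_comm j i A, hQ.step_comm hT hj hi hij.symm]
  | trans h₁ _ ih₁ ih₂ =>
    intro A T hT hn hA
    rw [ih₁ hT hn hA]
    exact ih₂ hT (h₁.nodup_iff.1 hn) fun a ha => hA a (h₁.mem_iff.2 ha)

variable (Q) in
/-- The expectation of the polynomial `f` when the remaining vertices are revealed. -/
noncomputable def ev (A : Finset (Fin n)) (T : St) (f : P.Poly) : ℝ :=
  Q.listExp Aᶜ.toList A T (fun T' => aeval (Q.val T') f)

/-- Any unrevealed `i` may be moved to the front of the list, so `ev` can be expanded along
whichever vertex is convenient. -/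
lemma Laws.ev_step (hQ : Q.Laws) {A : Finset (Fin n)} {T : St} (hT : Q.Reach A T)
    {i : Fin n} (hi : i ∉ A) (f : P.Poly) :
    Q.ev A T f = Q.step A T i (fun T' => Q.ev (insert i A) T' f) / ((n : ℝ) - A.card) := by
  have h : Aᶜ.toList.Perm (i :: (insert i A)ᶜ.toList) := by
    rw [List.perm_ext_iff_of_nodup (Finset.nodup_toList _)
      (by simp [Finset.nodup_toList])]
    intro a
    by_cases ha : a = i <;> simp [ha, hi]
  rw [ev, hQ.listExp_perm _ h hT (Finset.nodup_toList _) (by simp)]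
  rfl

lemma Laws.ev_step_mul (hQ : Q.Laws) {A : Finset (Fin n)} {T : St} (hT : Q.Reach A T)
    {i : Fin n} (hi : i ∉ A) (f : P.Poly) :
    Q.step A T i (fun T' => Q.ev (insert i A) T' f) = ((n : ℝ) - A.card) * Q.ev A T f := by
  rw [hQ.ev_step hT hi, mul_div_cancel₀ _ (cast_sub_card_ne_zero hi)]

/-- Induction over the set of vertices which are not yet revealed. -/
lemma reach_induction {p : Finset (Fin n) → St → Prop}
    (huniv : ∀ T, Q.Reach Finset.univ T → p Finset.univ T)
    (hstep : ∀ A T i, Q.Reach A T → i ∉ A →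
      (∀ o ∈ Q.outcomes A T, p (insert i A) (Q.next T i o)) → p A T)
    {A : Finset (Fin n)} {T : St} (hT : Q.Reach A T) : p A T := by
  induction h : Aᶜ.card generalizing A T with
  | zero =>
    obtain rfl : A = Finset.univ := by simpa using h
    exact huniv T hT
  | succ m ih =>
    obtain ⟨i, hi⟩ : Aᶜ.Nonempty := Finset.card_pos.1 (by lia)
    have hi' : i ∉ A := by simpa using hi
    refine hstep A T i hT hi' fun o ho => ih (hT.step hi' ho) ?_
    rw [Finset.card_compl, Finset.card_insert_of_notMem hi']
    rw [Finset.card_compl] at h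
    lia

lemma ev_univ (T : St) (f : P.Poly) : Q.ev Finset.univ T f = aeval (Q.val T) f := by
  simp [ev, listExp]

lemma aeval_congr_of_mem_polysOn {B : Finset (Fin n)} {f : P.Poly} (hf : f ∈ P.polysOn B)
    {x y : P.edges → ℝ} (h : ∀ e : P.edges, e.1 ⊆ B → x e = y e) : aeval x f = aeval y f := by
  refine eval₂Hom_congr' rfl (fun e he _ => h e ?_) rfl
  exact mem_supported.1 hf he

/-- A factor which only depends on revealed vertices can be pulled out. -/
lemma Laws.ev_mul_left (hQ : Q.Laws) {A : Finset (Fin n)} {T : St} (hT : Q.Reach A T)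
    (g : P.Poly) : ∀ f ∈ P.polysOn A, Q.ev A T (f * g) = aeval (Q.val T) f * Q.ev A T g := by
  refine reach_induction (p := fun A T => ∀ f ∈ P.polysOn A,
    Q.ev A T (f * g) = aeval (Q.val T) f * Q.ev A T g) ?_ ?_ hT
  · intro T _ f _
    simp [ev_univ]
  · intro A T i hT hi ih f hf
    rw [hQ.ev_step hT hi, hQ.ev_step hT hi g, ← mul_div_assoc, ← step_mul]
    congr 1
    refine step_congr fun o ho => ?_
    rw [ih o ho f (P.polysOn_mono (Finset.subset_insert _ _) hf)]
    congr 1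
    exact aeval_congr_of_mem_polysOn hf (hQ.val_next hT hi ho)

lemma Laws.ev_add (hQ : Q.Laws) {A : Finset (Fin n)} {T : St} (hT : Q.Reach A T)
    (f g : P.Poly) : Q.ev A T (f + g) = Q.ev A T f + Q.ev A T g := by
  refine reach_induction (p := fun A T => Q.ev A T (f + g) = Q.ev A T f + Q.ev A T g) ?_ ?_ hT
  · intro T _
    simp [ev_univ]
  · intro A T i hT hi ih
    rw [hQ.ev_step hT hi, hQ.ev_step hT hi f, hQ.ev_step hT hi g, ← add_div, ← step_add]
    congr 1
    exact step_congr ih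

lemma Laws.ev_C_mul (hQ : Q.Laws) {A : Finset (Fin n)} {T : St} (hT : Q.Reach A T)
    (c : ℝ) (g : P.Poly) : Q.ev A T (C c * g) = c * Q.ev A T g := by
  have hc : (C c : P.Poly) ∈ P.polysOn A := Subalgebra.algebraMap_mem _ c
  rw [hQ.ev_mul_left hT g _ hc]
  simp

lemma Laws.ev_one (hQ : Q.Laws) {A : Finset (Fin n)} {T : St} (hT : Q.Reach A T) :
    Q.ev A T 1 = 1 := by
  refine reach_induction (p := fun A T => Q.ev A T 1 = 1) ?_ ?_ hT
  · intro T _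
    simp [ev_univ]
  · intro A T i hT hi ih
    rw [hQ.ev_step hT hi, step_congr (ψ := fun _ => 1) ih, hQ.step_const hT, mul_one,
      div_self (cast_sub_card_ne_zero hi)]

lemma Laws.ev_of_mem_polysOn (hQ : Q.Laws) {A : Finset (Fin n)} {T : St}
    (hT : Q.Reach A T) {f : P.Poly} (hf : f ∈ P.polysOn A) :
    Q.ev A T f = aeval (Q.val T) f := by
  simpa [hQ.ev_one hT] using hQ.ev_mul_left hT 1 f hf

/-- The expectation as a linear map. -/
noncomputable def Laws.evLinear (hQ : Q.Laws) {A : Finset (Fin n)} {T : St}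
    (hT : Q.Reach A T) : P.Poly →ₗ[ℝ] ℝ where
  toFun := Q.ev A T
  map_add' := hQ.ev_add hT
  map_smul' c f := by rw [smul_eq_C_mul, hQ.ev_C_mul hT]; rfl

lemma Laws.ev_sum (hQ : Q.Laws) {A : Finset (Fin n)} {T : St} (hT : Q.Reach A T)
    {ι : Type*} (s : Finset ι) (f : ι → P.Poly) :
    Q.ev A T (∑ v ∈ s, f v) = ∑ v ∈ s, Q.ev A T (f v) :=
  map_sum (hQ.evLinear hT) f s

lemma Laws.ev_sub (hQ : Q.Laws) {A : Finset (Fin n)} {T : St} (hT : Q.Reach A T)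
    (f g : P.Poly) : Q.ev A T (f - g) = Q.ev A T f - Q.ev A T g :=
  map_sub (hQ.evLinear hT) f g

lemma Laws.ev_C (hQ : Q.Laws) {A : Finset (Fin n)} {T : St} (hT : Q.Reach A T)
    (c : ℝ) : Q.ev A T (C c) = c := by
  simpa [hQ.ev_one hT] using hQ.ev_C_mul hT c 1

/-- A polynomial which vanishes in all states has expectation zero. -/
lemma Laws.ev_eq_zero (hQ : Q.Laws) {A : Finset (Fin n)} {T : St} (hT : Q.Reach A T)
    {f : P.Poly} (hf : ∀ T, aeval (Q.val T) f = 0) : Q.ev A T f = 0 := by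
  refine reach_induction (p := fun A T => Q.ev A T f = 0) ?_ ?_ hT
  · intro T _
    rw [ev_univ, hf]
  · intro A T i hT hi ih
    rw [hQ.ev_step hT hi, step_congr (ψ := fun _ => 0) ih, hQ.step_const hT]
    simp

lemma Laws.ev_X_sq_sub_X (hQ : Q.Laws) (hval : ∀ T e, Q.val T e = 0 ∨ Q.val T e = 1)
    {A : Finset (Fin n)} {T : St} (hT : Q.Reach A T) (e : P.edges) :
    Q.ev A T (X e ^ 2 - X e) = 0 := by
  refine hQ.ev_eq_zero hT fun T => ?_
  rcases hval T e with h | h <;> simp [h]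

/-! ### Invariance under relabelling -/

lemma Laws.act_of_fix (hQ : Q.Laws) {A : Finset (Fin n)} {T : St} (hT : Q.Reach A T)
    {σ : Equiv.Perm (Fin n)} (hσ : ∀ a ∈ A, σ a = a) : Q.act σ T = T := by
  cases hT with
  | init => exact hQ.act_init σ
  | step hT hi ho =>
    rw [hQ.act_next hT hi ho σ fun a ha => hσ a (Finset.mem_insert_of_mem ha),
      hσ _ (Finset.mem_insert_self _ _)]

lemma Laws.listExp_act (hQ : Q.Laws) (σ : Equiv.Perm (Fin n)) (φ : St → ℝ) :
    ∀ (L : List (Fin n)) {A : Finset (Fin n)} {T : St}, Q.Reach A T → L.Nodup →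
      (∀ a ∈ L, a ∉ A) → Q.listExp (L.map σ) (A.map σ.toEmbedding) (Q.act σ T) φ =
        Q.listExp L A T (fun T' => φ (Q.act σ T'))
  | [], _, _, _, _, _ => rfl
  | i :: L, A, T, hT, hn, hA => by
    have hi : i ∉ A := hA i (by simp)
    rw [List.nodup_cons] at hn
    simp only [List.map_cons, listExp, Finset.card_map]
    congr 1
    rw [hQ.step_act hT hi]
    refine step_congr fun o ho => ?_
    have := hQ.listExp_act σ φ L (hT.step hi ho) hn.2 fun a ha => by
      rw [Finset.mem_insert, not_or]
      exact ⟨fun h => hn.1 (h ▸ ha), hA a (by simp [ha])⟩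
    rw [← this, Finset.map_insert]
    rfl

/-- Relabelling turns the chosen enumeration of the complement into some enumeration of the image
complement; independence of the order absorbs the difference. This is why the image state must be
reachable. -/
lemma Laws.ev_map (hQ : Q.Laws) {A : Finset (Fin n)} {T : St} (hT : Q.Reach A T)
    {σ : Equiv.Perm (Fin n)} (hσT : Q.Reach (A.map σ.toEmbedding) (Q.act σ T)) (f : P.Poly) :
    Q.ev (A.map σ.toEmbedding) (Q.act σ T) (P.permPoly σ f) = Q.ev A T f := by
  have hperm : (A.map σ.toEmbedding)ᶜ.toList.Perm (Aᶜ.toList.map σ) := by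
    rw [List.perm_ext_iff_of_nodup (Finset.nodup_toList _)
      ((Finset.nodup_toList _).map σ.injective)]
    intro a
    obtain ⟨b, rfl⟩ := σ.surjective a
    simp
  rw [ev, hQ.listExp_perm _ hperm hσT (Finset.nodup_toList _) (by simp),
    hQ.listExp_act σ _ Aᶜ.toList hT (Finset.nodup_toList _) (by simp), ev]
  congr 1
  funext T'
  rw [permPoly, aeval_rename]
  congr 2
  funext e
  exact hQ.val_act σ T' e

lemma map_eq_of_fix {A : Finset (Fin n)} {σ : Equiv.Perm (Fin n)} (hσ : ∀ a ∈ A, σ a = a) :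
    A.map σ.toEmbedding = A := by
  refine (Finset.eq_of_subset_of_card_le (fun a ha => ?_) (by simp)).symm
  exact Finset.mem_map.2 ⟨a, ha, hσ a ha⟩

/-- The expectation is invariant under permutations of the vertices which are not revealed. -/
lemma Laws.ev_permPoly (hQ : Q.Laws) {A : Finset (Fin n)} {T : St} (hT : Q.Reach A T)
    {σ : Equiv.Perm (Fin n)} (hσ : ∀ a ∈ A, σ a = a) (f : P.Poly) :
    Q.ev A T (P.permPoly σ f) = Q.ev A T f := by
  have h := hQ.ev_map hT (σ := σ) (by rwa [map_eq_of_fix hσ, hQ.act_of_fix hT hσ]) f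
  rwa [map_eq_of_fix hσ, hQ.act_of_fix hT hσ] at h

/-! ### Averaging over the position of the revealed vertex -/

lemma swap_fix {A : Finset (Fin n)} {i j : Fin n} (hi : i ∉ A) (hj : j ∉ A) :
    ∀ a ∈ A, Equiv.swap i j a = a := fun _ ha =>
  Equiv.swap_apply_of_ne_of_ne (fun h => hi (h ▸ ha)) (fun h => hj (h ▸ ha))

lemma Laws.ev_swap (hQ : Q.Laws) {A : Finset (Fin n)} {T : St} (hT : Q.Reach A T)
    {i j : Fin n} (hi : i ∉ A) (hj : j ∉ A) {o : O} (ho : o ∈ Q.outcomes A T)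
    (f : P.Poly) :
    Q.ev (insert i A) (Q.next T i o) (P.permPoly (Equiv.swap i j) f) =
      Q.ev (insert j A) (Q.next T j o) f := by
  have h₁ : (insert j A).map (Equiv.swap i j).toEmbedding = insert i A := by
    rw [Finset.map_insert, map_eq_of_fix (swap_fix hi hj)]
    simp
  have h₂ : Q.act (Equiv.swap i j) (Q.next T j o) = Q.next T i o := by
    rw [hQ.act_next hT hj ho _ (swap_fix hi hj), Equiv.swap_apply_right]
  have h := hQ.ev_map (hT.step hj ho) (σ := Equiv.swap i j)
    (by rw [h₁, h₂]; exact hT.step hi ho) f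
  rwa [h₁, h₂] at h

lemma permPoly_eq_self {B : Finset (Fin n)} {f : P.Poly} (hf : f ∈ P.polysOn B)
    {σ : Equiv.Perm (Fin n)} (hσ : ∀ a ∈ B, σ a = a) : P.permPoly σ f = f := by
  have h : P.permPoly σ f = rename id f := by
    rw [permPoly, rename_eq_aeval, rename_eq_aeval]
    refine eval₂Hom_congr' rfl (fun e he _ => ?_) rfl
    have he : e.1 ⊆ B := mem_supported.1 hf he
    simp only [Function.comp_apply, id]
    congr 1
    exact Subtype.ext (map_eq_of_fix fun a ha => hσ a (he ha))
  rw [h, rename_id_apply]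

/-- Averaging over the position of `i` undoes the effect of revealing `i`. -/
lemma Laws.sum_ev_swap_of_notMem (hQ : Q.Laws) {B : Finset (Fin n)} {f : P.Poly}
    (hf : f ∈ P.polysOn B) {i : Fin n} (hiB : i ∉ B) {A : Finset (Fin n)} {T : St}
    (hT : Q.Reach A T) (hi : i ∉ A) {o : O} (ho : o ∈ Q.outcomes A T) :
    ∑ v ∈ Aᶜ, Q.ev (insert i A) (Q.next T i o) (P.permPoly (Equiv.swap i v) f) =
      ((n : ℝ) - A.card) * Q.ev A T f := by
  induction hc : (B \ A).card generalizing A T o with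
  | zero =>
    -- All vertices of `f` are revealed: each of the `n - |A|` summands is the known value of `f`.
    have hBA : B ⊆ A := by simpa using hc
    have hfA := P.polysOn_mono hBA hf
    have h : ∀ v ∈ Aᶜ, Q.ev (insert i A) (Q.next T i o) (P.permPoly (Equiv.swap i v) f) =
        Q.ev A T f := fun v hv => by
      rw [permPoly_eq_self hfA (swap_fix hi (by simpa using hv)),
        hQ.ev_of_mem_polysOn (hT.step hi ho) (P.polysOn_mono (Finset.subset_insert _ _) hfA),
        hQ.ev_of_mem_polysOn hT hfA]
      exact aeval_congr_of_mem_polysOn hfA (hQ.val_next hT hi ho)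
    rw [Finset.sum_congr rfl h, Finset.sum_const, nsmul_eq_mul, Finset.card_compl,
      Fintype.card_fin, Nat.cast_sub (by simpa using A.card_le_univ)]
  | succ m ih =>
    obtain ⟨j, hjBA⟩ : (B \ A).Nonempty := Finset.card_pos.1 (by lia)
    obtain ⟨hjB, hj⟩ := Finset.mem_sdiff.1 hjBA
    have hij : i ≠ j := fun h => hiB (h ▸ hjB)
    have hiA : i ∉ insert j A := by simp [hij, hi]
    have hjA : j ∉ insert i A := by simp [hij.symm, hj]
    have hsub : (Aᶜ : Finset (Fin n)) = insert j (insert j A)ᶜ := by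
      ext a
      by_cases ha : a = j <;> simp [ha, hj]
    have hm : (B \ insert j A).card = m := by
      rw [Finset.sdiff_insert, Finset.card_erase_of_mem hjBA]
      lia
    have hT' := hT.step hi ho
    -- Reveal a further vertex `j` of `B`. By induction the average over `v ≠ j` no longer depends
    -- on the outcome of `i`, which is exactly the hypothesis of `step_remove`.
    have key := hQ.step_remove hT hi hj hij ho
      (fun T' => ((n : ℝ) - (insert j A).card) * Q.ev (insert j A) T' f)
      (fun T' => ∑ v ∈ (insert j A)ᶜ,
        Q.ev (insert i (insert j A)) T' (P.permPoly (Equiv.swap i v) f))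
      (fun o₁ ho₁ o₂ ho₂ => ih (hT.step hj ho₁) hiA ho₂ hm)
    rw [step_mul, hQ.ev_step_mul hT hj, step_sum] at key
    have hcard : ((insert j A).card : ℝ) = A.card + 1 := by
      rw [Finset.card_insert_of_notMem hj]; push_cast; ring
    have hcard' : ((insert i A).card : ℝ) = A.card + 1 := by
      rw [Finset.card_insert_of_notMem hi]; push_cast; ring
    have h₁ : ∀ v, Q.step (insert i A) (Q.next T i o) j (fun T' =>
        Q.ev (insert i (insert j A)) T' (P.permPoly (Equiv.swap i v) f)) =
        ((n : ℝ) - A.card - 1) *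
          Q.ev (insert i A) (Q.next T i o) (P.permPoly (Equiv.swap i v) f) := fun v => by
      rw [Finset.insert_comm, hQ.ev_step_mul hT' hjA, hcard']
      ring
    simp only [h₁, hcard] at key
    rw [← Finset.mul_sum] at key
    have hne : (n : ℝ) - A.card - 1 ≠ 0 := by
      have := cast_sub_card_ne_zero hiA
      rw [hcard] at this
      intro h
      exact this (by linarith)
    -- The missing summand `v = j` equals the expectation after giving `o` to `j`, hence the
    -- correction term of `step_remove`.
    rw [hsub, Finset.sum_insert (by simp), hQ.ev_swap hT hi hj ho]
    refine mul_left_cancel₀ hne ?_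
    linear_combination key

lemma permPoly_mul (σ τ : Equiv.Perm (Fin n)) (f : P.Poly) :
    P.permPoly (σ * τ) f = P.permPoly σ (P.permPoly τ f) := by
  rw [permPoly, permPoly, permPoly, rename_rename]
  congr 2
  funext e
  refine Subtype.ext ?_
  simp only [permEdge, Function.comp_apply, Finset.map_map]
  rfl

lemma monomial_mem_polysOn (m : P.edges →₀ ℕ) (c : ℝ) :
    monomial m c ∈ P.polysOn (P.indices m) := by
  refine mem_supported.2 fun e he => ?_
  obtain ⟨d, hd, hed⟩ := (mem_vars_iff_mem_support e).1 he
  rw [Finset.mem_singleton.1 (support_monomial_subset hd)] at hed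
  exact Finset.subset_biUnion_of_mem (fun e : P.edges => e.1) hed

/-- If the monomial involves `i`, exchange `i` with a vertex `j` outside `A` and the monomial. The
degree bound provides this spare vertex, and neither side changes. -/
lemma Laws.sum_ev_swap_monomial (hQ : Q.Laws) {A : Finset (Fin n)} {T : St}
    (hT : Q.Reach A T) {i : Fin n} (hi : i ∉ A) {o : O} (ho : o ∈ Q.outcomes A T)
    (m : P.edges →₀ ℕ) (c : ℝ) (hm : (P.indices m \ A).card + 1 + A.card ≤ n) :
    ∑ v ∈ Aᶜ, Q.ev (insert i A) (Q.next T i o) (P.permPoly (Equiv.swap i v) (monomial m c)) =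
      ((n : ℝ) - A.card) * Q.ev A T (monomial m c) := by
  set B := P.indices m
  by_cases hiB : i ∉ B
  · exact hQ.sum_ev_swap_of_notMem (monomial_mem_polysOn m c) hiB hT hi ho
  obtain ⟨j, hj⟩ : (A ∪ B)ᶜ.Nonempty := by
    rw [← Finset.card_pos, Finset.card_compl, Fintype.card_fin, Finset.union_comm,
      ← Finset.card_sdiff_add_card]
    lia
  obtain ⟨hjA, hjB⟩ : j ∉ A ∧ j ∉ B := by simpa using hj
  have hij : i ≠ j := fun h => hiB (h ▸ hjB)
  set p : P.Poly := monomial m c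
  set p' := P.permPoly (Equiv.swap i j) p
  have hp' : p' = monomial (m.mapDomain (P.permEdge (Equiv.swap i j))) c := rename_monomial _ _ _
  have hiB' : i ∉ P.indices (m.mapDomain (P.permEdge (Equiv.swap i j))) := by
    rw [indices_mapDomain]
    intro h
    obtain ⟨a, ha, hai⟩ := Finset.mem_map.1 h
    have : a = j := by
      have := congrArg (Equiv.swap i j) hai
      simpa using this
    exact hjB (this ▸ ha)
  have key := hQ.sum_ev_swap_of_notMem (hp' ▸ monomial_mem_polysOn _ c) hiB' hT hi ho
  rw [hQ.ev_permPoly hT (swap_fix hi hjA)] at key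
  rw [← key]
  have hpp : p = P.permPoly (Equiv.swap i j) p' := by
    rw [← permPoly_mul, Equiv.swap_mul_self]
    exact (permPoly_eq_self (monomial_mem_polysOn m c) (by simp)).symm
  have hself : ∀ (i : Fin n) (f : P.Poly), P.permPoly (Equiv.swap i i) f = f := fun i f => by
    exact permPoly_eq_self (B := Finset.univ)
      (mem_supported.2 fun e _ => Finset.subset_univ _) (by simp)
  have hiA' : i ∈ Aᶜ := by simpa using hi
  have hjA' : j ∈ Aᶜ.erase i := by simpa [hij.symm] using hjA
  rw [← Finset.add_sum_erase _ _ hiA', ← Finset.add_sum_erase _ _ hiA',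
    ← Finset.add_sum_erase _ _ hjA', ← Finset.add_sum_erase _ _ hjA', hself, hself, ← hpp]
  have : ∀ v ∈ (Aᶜ.erase i).erase j,
      Q.ev (insert i A) (Q.next T i o) (P.permPoly (Equiv.swap i v) p) =
      Q.ev (insert i A) (Q.next T i o) (P.permPoly (Equiv.swap i v) p') := fun v hv => by
    have hv' : v ≠ j ∧ v ≠ i ∧ v ∉ A := by simpa using hv
    -- Conjugating `swap i j` by `swap i v` gives `swap j v`, which fixes all of `insert i A` and so
    -- can be dropped.
    have hperm : Equiv.swap i v * Equiv.swap i j = Equiv.swap j v * Equiv.swap i v := by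
      ext a
      simp only [Equiv.Perm.mul_apply, Equiv.swap_apply_def]
      grind
    nth_rewrite 1 [hpp]
    rw [← permPoly_mul, hperm, permPoly_mul]
    exact hQ.ev_permPoly (hT.step hi ho) (swap_fix (by simp [hij.symm, hjA])
      (by simp [hv'.2.1, hv'.2.2])) _
  rw [Finset.sum_congr rfl this]
  -- The summands for `v = i` and `v = j` trade places between `p` and `p'`.
  change _ + (Q.ev _ _ p' + _) = _ + _
  ring

lemma Laws.sum_ev_swap (hQ : Q.Laws) {A : Finset (Fin n)} {T : St}
    (hT : Q.Reach A T) {i : Fin n} (hi : i ∉ A) {o : O} (ho : o ∈ Q.outcomes A T)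
    {f : P.Poly} (hf : P.indexDeg A f + 1 + A.card ≤ n) :
    ∑ v ∈ Aᶜ, Q.ev (insert i A) (Q.next T i o) (P.permPoly (Equiv.swap i v) f) =
      ((n : ℝ) - A.card) * Q.ev A T f := by
  have h : ∀ v, P.permPoly (Equiv.swap i v) f =
      ∑ m ∈ f.support, P.permPoly (Equiv.swap i v) (monomial m (f.coeff m)) := fun v => by
    conv_lhs => rw [f.as_sum]
    exact map_sum _ _ _
  conv_rhs => rw [f.as_sum]
  simp only [h, hQ.ev_sum (hT.step hi ho), hQ.ev_sum hT]
  rw [Finset.sum_comm, Finset.mul_sum]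
  refine Finset.sum_congr rfl fun m hm => hQ.sum_ev_swap_monomial hT hi ho m _ ?_
  have := P.indexDeg_le_iff.1 (le_refl (P.indexDeg A f)) m hm
  lia

/-- The expectation of a symmetric polynomial does not change when a vertex is revealed. -/
lemma Laws.ev_next (hQ : Q.Laws) {A : Finset (Fin n)} {T : St}
    (hT : Q.Reach A T) {i : Fin n} (hi : i ∉ A) {o : O} (ho : o ∈ Q.outcomes A T)
    {f : P.Poly} (hf : P.indexDeg A f + 1 + A.card ≤ n) (hs : P.IsSymmetricOutside A f) :
    Q.ev (insert i A) (Q.next T i o) f = Q.ev A T f := by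
  have h := hQ.sum_ev_swap hT hi ho hf
  rw [Finset.sum_congr rfl fun v hv => by
      rw [hs _ (swap_fix hi (by simpa using hv))], Finset.sum_const, nsmul_eq_mul,
    Finset.card_compl, Fintype.card_fin, Nat.cast_sub (by simpa using A.card_le_univ)] at h
  exact mul_left_cancel₀ (cast_sub_card_ne_zero hi) h

/-! ### Multiplicativity and products with equations -/

lemma indexDeg_mono {A A' : Finset (Fin n)} (h : A ⊆ A') (f : P.Poly) :
    P.indexDeg A' f ≤ P.indexDeg A f :=
  P.indexDeg_le_iff.2 fun m hm => (Finset.card_le_card (Finset.sdiff_subset_sdiff le_rfl h)).trans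
    (P.indexDeg_le_iff.1 le_rfl m hm)

lemma isSymmetricOutside_mono {A A' : Finset (Fin n)} (h : A ⊆ A') {f : P.Poly}
    (hf : P.IsSymmetricOutside A f) : P.IsSymmetricOutside A' f :=
  fun σ hσ => hf σ fun a ha => hσ a (h ha)

/-- Reveal the vertices of `B` one at a time until `f` is a known number. Each step moves one unit
from `|B \ A|` to `|A|`, so the budget is preserved, and `ev_next` keeps the expectation of `g`
fixed. No symmetry of `f` is involved. -/
lemma Laws.ev_mul_of_symmetric_right (hQ : Q.Laws) {B : Finset (Fin n)} {f g : P.Poly}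
    (hf : f ∈ P.polysOn B) {A : Finset (Fin n)} {T : St} (hT : Q.Reach A T)
    (hg : P.IsSymmetricOutside A g) (hd : (B \ A).card + P.indexDeg A g + A.card ≤ n) :
    Q.ev A T (f * g) = Q.ev A T f * Q.ev A T g := by
  induction hc : (B \ A).card generalizing A T with
  | zero =>
    have hfA := P.polysOn_mono (show B ⊆ A by simpa using hc) hf
    rw [hQ.ev_mul_left hT _ _ hfA, hQ.ev_of_mem_polysOn hT hfA]
  | succ m ih =>
    obtain ⟨j, hjBA⟩ : (B \ A).Nonempty := Finset.card_pos.1 (by lia)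
    obtain ⟨hjB, hj⟩ := Finset.mem_sdiff.1 hjBA
    have hm : (B \ insert j A).card = m := by
      rw [Finset.sdiff_insert, Finset.card_erase_of_mem hjBA]
      lia
    have hsub := Finset.subset_insert j A
    have hle := indexDeg_mono hsub g
    rw [hQ.ev_step hT hj, hQ.ev_step hT hj f, div_mul_eq_mul_div, mul_comm (Q.step A T j _),
      ← step_mul]
    congr 1
    refine step_congr fun o ho => ?_
    rw [ih (hT.step hj ho) (isSymmetricOutside_mono hsub hg)
      (by rw [hm, Finset.card_insert_of_notMem hj]; lia) hm,
      hQ.ev_next hT hj ho (by lia) hg, mul_comm]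

/-- Once `B` is revealed, `f` is a number and only the expectation of `s` remains; at least `D`
vertices are then still unrevealed. -/
lemma Laws.ev_mul_monomial_eq_zero (hQ : Q.Laws) {B : Finset (Fin n)} {f s : P.Poly}
    (hf : f ∈ P.polysOn B) {D : ℕ} {A : Finset (Fin n)} {T : St} (hT : Q.Reach A T)
    (hs : ∀ A' T', Q.Reach A' T' → A ⊆ A' → A'.card + D ≤ n → Q.ev A' T' s = 0)
    (hd : (B \ A).card + D + A.card ≤ n) :
    Q.ev A T (f * s) = 0 := by
  induction hc : (B \ A).card generalizing A T with
  | zero =>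
    rw [hQ.ev_mul_left hT _ _ (P.polysOn_mono (show B ⊆ A by simpa using hc) hf),
      hs A T hT le_rfl (by lia), mul_zero]
  | succ m ih =>
    obtain ⟨j, hjBA⟩ : (B \ A).Nonempty := Finset.card_pos.1 (by lia)
    obtain ⟨hjB, hj⟩ := Finset.mem_sdiff.1 hjBA
    have hm : (B \ insert j A).card = m := by
      rw [Finset.sdiff_insert, Finset.card_erase_of_mem hjBA]
      lia
    rw [hQ.ev_step hT hj, step_congr (ψ := fun _ => 0) fun o ho => ih (hT.step hj ho)
      (fun A' T' h h' => hs A' T' h ((Finset.subset_insert _ _).trans h'))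
      (by rw [hm, Finset.card_insert_of_notMem hj]; lia) hm, hQ.step_const hT]
    simp

lemma Laws.ev_mul_eq_zero (hQ : Q.Laws) {f s : P.Poly} {A : Finset (Fin n)} {T : St}
    (hT : Q.Reach A T)
    (hs : ∀ A' T', Q.Reach A' T' → A ⊆ A' → A'.card + P.indexDeg A s ≤ n → Q.ev A' T' s = 0)
    (hd : P.indexDeg A f + P.indexDeg A s + A.card ≤ n) :
    Q.ev A T (f * s) = 0 := by
  rw [f.as_sum, Finset.sum_mul, hQ.ev_sum hT]
  refine Finset.sum_eq_zero fun m hm =>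
    hQ.ev_mul_monomial_eq_zero (monomial_mem_polysOn m _) hT hs ?_
  have := P.indexDeg_le_iff.1 (le_refl (P.indexDeg A f)) m hm
  lia

lemma Laws.ev_mul_of_symmetric (hQ : Q.Laws) {f g : P.Poly} {A : Finset (Fin n)} {T : St}
    (hT : Q.Reach A T) (hg : P.IsSymmetricOutside A g)
    (hd : P.indexDeg A f + P.indexDeg A g + A.card ≤ n) :
    Q.ev A T (f * g) = Q.ev A T f * Q.ev A T g := by
  conv_lhs => rw [f.as_sum]
  conv_rhs => rw [f.as_sum]
  rw [Finset.sum_mul, hQ.ev_sum hT, hQ.ev_sum hT, Finset.sum_mul]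
  refine Finset.sum_congr rfl fun m hm =>
    hQ.ev_mul_of_symmetric_right (monomial_mem_polysOn m _) hT hg ?_
  have := P.indexDeg_le_iff.1 (le_refl (P.indexDeg A f)) m hm
  lia

/-- The expectation of a fully symmetric polynomial is the same in all states which leave enough
vertices unrevealed. -/
lemma Laws.ev_eq_init (hQ : Q.Laws) {f : P.Poly} (hf : P.IsSymmetricOutside ∅ f)
    {A : Finset (Fin n)} {T : St} (hT : Q.Reach A T) (hd : P.indexDeg ∅ f + A.card ≤ n) :
    Q.ev A T f = Q.ev ∅ Q.init f := by
  induction hT with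
  | init => rfl
  | @step A T i o hT hi ho ih =>
    rw [Finset.card_insert_of_notMem hi] at hd
    have hle := indexDeg_mono (Finset.empty_subset A) f
    rw [hQ.ev_next hT hi ho (by lia) (isSymmetricOutside_mono (Finset.empty_subset A) hf),
      ih (by lia)]

end QueryProcess

/-! ### Strategies which play a process -/

namespace QueryProcess

variable {n : ℕ} {P : SymmetricProblem n} {St O : Type} (Q : QueryProcess P St O)

/-- The strategy `S` plays according to the process `Q` from the state `T`, and the probabilities
of the first `R` queries are nonnegative. -/
def Realizes (R : ℕ) : {A : List (Fin n)} → {d : ℕ} → P.Strategy A d → St → Prop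
  | _, _, .leaf A E, T => E = P.evalOn A.toFinset (Q.val T)
  | _, _, .node A _ E outcome fin p next, T =>
      E = P.evalOn A.toFinset (Q.val T) ∧
      ∀ (i : Fin n) (hi : i ∉ A), ∃ τ : outcome i hi → O,
        (∀ j, τ j ∈ Q.outcomes A.toFinset T) ∧
        (∀ j, A.length < R → 0 ≤ p i hi j) ∧
        (∀ j, Realizes R (next i hi j) (Q.next T i (τ j))) ∧
        -- Testing against all `φ` says that `τ` carries the probabilities of the strategy to the
        -- normalized weights.
        ∀ φ : O → ℝ,
          (letI := fin i hi
           ∑ j, p i hi j * φ (τ j)) =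
            (∑ o ∈ Q.outcomes A.toFinset T, Q.weight A.toFinset T o * φ o) /
              ((n : ℝ) - A.toFinset.card)

variable {Q} {R : ℕ}

lemma Realizes.base_eq {A : List (Fin n)} {d : ℕ} {S : P.Strategy A d} {T : St}
    (h : Q.Realizes R S T) : S.base = P.evalOn A.toFinset (Q.val T) := by
  cases S with
  | leaf A E => exact h
  | node A d E outcome fin p next => exact h.1

lemma toFinset_append_singleton (A : List (Fin n)) (i : Fin n) :
    (A ++ [i]).toFinset = insert i A.toFinset := by
  ext; simp

lemma Laws.isStory (hQ : Q.Laws) {A : List (Fin n)} {d : ℕ} (S : P.Strategy A d) :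
    ∀ {T : St}, Q.Realizes R S T → Q.Reach A.toFinset T → A.Nodup → A.length + d = n →
      S.IsStory := by
  induction S with
  | leaf A E => exact fun _ _ hn _ => hn
  | node A d E outcome fin p next ih =>
    intro T h hT hn hd
    obtain ⟨rfl, h⟩ := h
    refine ⟨hn, by lia, fun i hi => ?_⟩
    obtain ⟨τ, hτ, -, hnext, hsum⟩ := h i hi
    have hi' : i ∉ A.toFinset := by simpa using hi
    refine ⟨?_, fun j => ⟨fun f hf => ?_, ih i hi j (hnext j) ?_ ?_ ?_⟩⟩
    · have h1 := hsum (fun _ => 1)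
      simp only [mul_one] at h1
      rw [h1, hQ.sum_weight hT, div_self (cast_sub_card_ne_zero hi')]
    · rw [(hnext j).base_eq]
      exact aeval_congr_of_mem_polysOn hf fun e he => (hQ.val_next hT hi' (hτ j) e he).symm
    · rw [toFinset_append_singleton]
      exact hT.step hi' (hτ j)
    · simp [List.nodup_append, hn]
      exact fun a ha h => hi (h ▸ ha)
    · simp; lia

/-- Both sides are expanded along the queries of `L`. At the end every variable of `f` is known, so
the vertices that `ev` still reveals have no influence. -/
lemma Laws.expect_eq (hQ : Q.Laws) {A : List (Fin n)} {d : ℕ} (S : P.Strategy A d) :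
    ∀ {T : St}, Q.Realizes R S T → Q.Reach A.toFinset T →
      ∀ {L : List (Fin n)}, Strategy.IsQuery A d L → ∀ (f : P.Poly)
        (hf : f ∈ P.polysOn (A ++ L).toFinset), S.expect L f hf = Q.ev A.toFinset T f := by
  induction S with
  | leaf A E =>
    intro T h hT L hL f hf
    obtain rfl : L = [] := by simpa using hL.2
    obtain rfl : E = _ := h
    rw [hQ.ev_of_mem_polysOn hT (by simpa using hf)]
    rfl
  | node A d E outcome fin p next ih =>
    intro T h hT L hL f hf
    obtain ⟨rfl, h⟩ := h
    match L, hL, hf with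
    | [], _, hf =>
      rw [hQ.ev_of_mem_polysOn hT (by simpa using hf)]
      rfl
    | i :: L, hL, hf =>
      have hi : i ∉ A := fun hi => by
        have := hL.1
        rw [List.nodup_append] at this
        exact this.2.2 i hi i (by simp) rfl
      obtain ⟨τ, hτ, -, hnext, hsum⟩ := h i hi
      have hi' : i ∉ A.toFinset := by simpa using hi
      rw [Strategy.expect, dif_pos hi, hQ.ev_step hT hi', step,
        ← hsum fun o => Q.ev (insert i A.toFinset) (Q.next T i o) f]
      refine Finset.sum_congr rfl fun j _ => ?_
      rw [ih i hi j (hnext j) (by rw [toFinset_append_singleton]; exact hT.step hi' (hτ j))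
        ⟨by simpa using hL.1, by simpa using hL.2⟩, toFinset_append_singleton]

variable (Q R) in
/-- After at most `R` queries all equations of `P` have expectation zero, as long as enough
vertices are left. -/
def SatisfiesEqs : Prop :=
  ∀ (A : Finset (Fin n)), A.card ≤ R → ∀ s ∈ P.eqs, ∀ (A' : Finset (Fin n)) (T : St),
    Q.Reach A' T → A ⊆ A' → A'.card + P.indexDeg A s ≤ n → Q.ev A' T s = 0

/-- Self-consistency is immediate because `ev` makes no reference to the query sequence. The bound
`A.length ≤ R` is needed only for the equations. -/
lemma Laws.isMimic (hQ : Q.Laws) (hE : Q.SatisfiesEqs R) {A : List (Fin n)} {d : ℕ}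
    (S : P.Strategy A d) {T : St} (h : Q.Realizes R S T) (hT : Q.Reach A.toFinset T)
    (hn : A.Nodup) (hd : A.length + d = n) (hR : A.length ≤ R) : S.IsMimic := by
  have hcard : A.toFinset.card = A.length := List.toFinset_card_of_nodup hn
  refine ⟨hQ.isStory S h hT hn hd, fun L L' hL hL' f hf hf' => ?_,
    (hQ.evLinear hT).domRestrict _, fun m hm L hL hL' => ?_, fun σ hσ f hf => ?_,
    fun s hs f hfs => ?_, fun f g hf hg hfg => ?_⟩
  · rw [hQ.expect_eq S h hT hL, hQ.expect_eq S h hT hL']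
  · rw [hQ.expect_eq S h hT hL]
    rfl
  · exact hQ.ev_permPoly hT hσ f
  · exact hQ.ev_mul_eq_zero hT (hE _ (hcard ▸ hR) s hs) (by lia)
  · exact hQ.ev_mul_of_symmetric hT hg (by lia)

/-- A strategy which realizes an exchangeable process is a good story. -/
theorem Laws.isGoodStory (hQ : Q.Laws) (hE : Q.SatisfiesEqs R) {A : List (Fin n)} {d : ℕ}
    (S : P.Strategy A d) : ∀ {T : St}, Q.Realizes R S T → Q.Reach A.toFinset T →
      A.Nodup → A.length + d = n → ∀ {r : ℕ}, A.length + r ≤ R → S.IsGoodStory r d := by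
  induction S with
  | leaf A E =>
    intro T h hT hn hd r hr
    have := hQ.isMimic hE _ h hT hn hd (by lia)
    cases r <;> exact this
  | node A d E outcome fin p next ih =>
    intro T h hT hn hd r hr
    have hm := hQ.isMimic hE _ h hT hn hd (by lia)
    cases r with
    | zero => exact hm
    | succ r =>
      refine ⟨hm, fun i hi j => ?_⟩
      obtain ⟨τ, hτ, hp, hnext, hsum⟩ := h.2 i hi
      have hi' : i ∉ A.toFinset := by simpa using hi
      refine ⟨hp j (by lia), ih i hi j (hnext j) ?_ ?_ ?_ ?_⟩
      · rw [toFinset_append_singleton]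
        exact hT.step hi' (hτ j)
      · simp [List.nodup_append, hn]
        exact fun a ha h => hi (h ▸ ha)
      · simp; lia
      · simp; lia

end QueryProcess

/-! ### Bounds on the index degree -/

namespace SymmetricProblem

variable {n : ℕ} {P : SymmetricProblem n}

lemma indexDeg_le_of_mem_polysOn {B : Finset (Fin n)} {f : P.Poly} (hf : f ∈ P.polysOn B)
    (A : Finset (Fin n)) : P.indexDeg A f ≤ (B \ A).card := by
  refine P.indexDeg_le_iff.2 fun m hm => Finset.card_le_card (Finset.sdiff_subset_sdiff ?_ le_rfl)
  refine Finset.biUnion_subset.2 fun e he => ?_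
  exact mem_supported.1 hf ((mem_vars_iff_mem_support e).2 ⟨m, hm, he⟩)

/-- Lower bounds matter: in `SatisfiesEqs` a large index degree of the equation is what forces
vertices to remain unrevealed. -/
lemma le_indexDeg {f : P.Poly} {m : P.edges →₀ ℕ} (hm : coeff m f ≠ 0) (A : Finset (Fin n)) :
    (P.indices m \ A).card ≤ P.indexDeg A f :=
  Finset.le_sup (f := fun m => (P.indices m \ A).card) (mem_support_iff.2 hm)

lemma X_mem_polysOn {e : P.edges} {B : Finset (Fin n)} (he : e.1 ⊆ B) :
    (X e : P.Poly) ∈ P.polysOn B :=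
  (X_mem_supported (R := ℝ)).2 he

lemma C_mem_lowIndexDeg (c : ℝ) (A : Finset (Fin n)) (d : ℕ) :
    (C c : P.Poly) ∈ P.lowIndexDeg A d :=
  (indexDeg_le_of_mem_polysOn (B := ∅) (Subalgebra.algebraMap_mem _ c) A).trans (by simp)

lemma mem_lowIndexDeg_of_mem_polysOn {B : Finset (Fin n)} {f : P.Poly} (hf : f ∈ P.polysOn B)
    (A : Finset (Fin n)) {d : ℕ} (hd : B.card ≤ d) : f ∈ P.lowIndexDeg A d :=
  (indexDeg_le_of_mem_polysOn hf A).trans ((Finset.card_le_card Finset.sdiff_subset).trans hd)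

lemma indices_single (e : P.edges) : P.indices (Finsupp.single e 1) = e.1 := by
  simp [indices]

lemma coeff_sum_X_sub_C (s : Finset P.edges) {e : P.edges} (he : e ∈ s) (c : ℝ) :
    coeff (Finsupp.single e 1) (∑ e ∈ s, X e - C c : P.Poly) = 1 := by
  classical
  have h : ∀ e' : P.edges, (Finsupp.single e' 1 : P.edges →₀ ℕ) = Finsupp.single e 1 ↔ e' = e :=
    fun e' => Finsupp.single_left_inj one_ne_zero
  rw [coeff_sub, coeff_sum, coeff_C, if_neg fun h => by simpa using congrArg (· e) h]
  simp [coeff_X, h, he]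

end SymmetricProblem

lemma card_tSubsets (n t : ℕ) : Fintype.card (tSubsets n t) = n.choose t := by
  simp

/-! ### Knapsack -/

/-- The process which takes `k` of `n` elements. -/
noncomputable def knapsackProcess (n : ℕ) (k : ℝ) :
    QueryProcess (knapsack n k) (Finset (Fin n)) Bool where
  outcomes _ _ := Finset.univ
  weight A T o := if o then k - T.card else (n : ℝ) - k - ((A.card : ℝ) - T.card)
  next T i o := if o then insert i T else T
  init := ∅
  act σ T := T.map σ.toEmbedding
  val T e := if e.1 ⊆ T then 1 else 0

namespace knapsackProcess

variable {n : ℕ} {k : ℝ}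

lemma step_eq (A T : Finset (Fin n)) (i : Fin n) (φ : Finset (Fin n) → ℝ) :
    (knapsackProcess n k).step A T i φ = (k - T.card) * φ (insert i T) +
      ((n : ℝ) - k - ((A.card : ℝ) - T.card)) * φ T := by
  simp [QueryProcess.step, knapsackProcess]

lemma next_eq (T : Finset (Fin n)) (i : Fin n) (o : Bool) :
    (knapsackProcess n k).next T i o = if o then insert i T else T := rfl

lemma subset_of_reach {A T : Finset (Fin n)} (h : (knapsackProcess n k).Reach A T) : T ⊆ A := by
  induction h with
  | init => exact le_rfl
  | @step A T i o _ _ _ ih =>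
    rw [next_eq]
    split_ifs
    · exact Finset.insert_subset_insert _ ih
    · exact ih.trans (Finset.subset_insert _ _)

lemma laws : (knapsackProcess n k).Laws where
  sum_weight {A T} _ := by
    simp [knapsackProcess]
    ring
  step_comm {A T} hT {i j} hi hj hij φ := by
    have hsub := subset_of_reach hT
    have hi' : i ∉ T := fun h => hi (hsub h)
    have hj' : j ∉ T := fun h => hj (hsub h)
    simp only [step_eq]
    rw [Finset.card_insert_of_notMem hi, Finset.card_insert_of_notMem hj,
      Finset.card_insert_of_notMem hi', Finset.card_insert_of_notMem hj', Finset.insert_comm i j]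
    push_cast
    ring
  step_remove {A T} hT {i j} hi hj hij {o} _ φ ψ h := by
    have hsub := subset_of_reach hT
    have hi' : i ∉ T := fun h => hi (hsub h)
    have hj' : j ∉ T := fun h => hj (hsub h)
    have h' : ∀ o₁ o₂, _ := fun o₁ o₂ => h o₁ (Finset.mem_univ _) o₂ (Finset.mem_univ _)
    simp only [next_eq] at h' ⊢
    simp only [step_eq]
    cases o
    · have h₁ := h' true false
      have h₂ := h' false false
      simp only [if_true, Bool.false_eq_true, if_false] at h₁ h₂ ⊢
      rw [h₁, h₂, Finset.card_insert_of_notMem hi]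
      push_cast
      ring
    · have h₁ := h' true true
      have h₂ := h' false true
      simp only [if_true, Bool.false_eq_true, if_false] at h₁ h₂ ⊢
      rw [Finset.insert_comm, h₁, h₂, Finset.card_insert_of_notMem hi,
        Finset.card_insert_of_notMem hi']
      push_cast
      ring
  step_act {A T} _ {i} _ σ φ := by
    have h : (knapsackProcess n k).act σ T = T.map σ.toEmbedding := rfl
    simp only [step_eq, h, Finset.card_map, ← Equiv.coe_toEmbedding, ← Finset.map_insert]
    rfl
  act_init σ := rfl
  act_next {A T} hT {i} _ {o} _ σ hσ := by
    have h : (knapsackProcess n k).act σ T = T :=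
      QueryProcess.map_eq_of_fix fun a ha => hσ a (subset_of_reach hT ha)
    change Finset.map σ.toEmbedding T = T at h
    change Finset.map σ.toEmbedding (if o then insert i T else T) = if o then insert (σ i) T else T
    cases o <;> simp [h]
  val_next {A T} hT {i} hi {o} _ e he := by
    have : e.1 ⊆ insert i T ↔ e.1 ⊆ T := Finset.subset_insert_iff_of_notMem fun h => hi (he h)
    change (if e.1 ⊆ (if o then insert i T else T) then (1 : ℝ) else 0) = if e.1 ⊆ T then 1 else 0
    cases o <;> simp [this]
  val_act σ T e := by
    simp [knapsackProcess, permEdge]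

lemma realizes {R : ℕ} (hR : R ≤ ⌊min k ((n : ℝ) - k)⌋₊ + 1) (hk : 0 ≤ k) (hkn : k ≤ n) (d : ℕ) :
    ∀ (A : List (Fin n)) (T : Finset (Fin n)), (knapsackProcess n k).Reach A.toFinset T →
      A.Nodup → (knapsackProcess n k).Realizes R (knapsackStoryFrom n k d A T) T := by
  induction d with
  | zero => exact fun _ _ _ _ => rfl
  | succ d ih =>
    intro A T hT hn
    have hcard : A.toFinset.card = A.length := List.toFinset_card_of_nodup hn
    refine ⟨rfl, fun i hi => ⟨fun j => j, fun j => Finset.mem_univ _, fun j hj => ?_,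
      fun j => ?_, fun φ => ?_⟩⟩
    · have hfl : (A.length : ℝ) ≤ min k ((n : ℝ) - k) :=
        (Nat.cast_le.2 (show A.length ≤ ⌊min k ((n : ℝ) - k)⌋₊ by lia)).trans
          (Nat.floor_le (le_min hk (by linarith)))
      have h1 := hfl.trans (min_le_left _ _)
      have h2 := hfl.trans (min_le_right _ _)
      have hTA : (T.card : ℝ) ≤ A.length := by
        rw [← hcard]; exact_mod_cast Finset.card_le_card (subset_of_reach hT)
      have : (0 : ℝ) ≤ T.card := Nat.cast_nonneg _
      cases j
      · simp only [Bool.false_eq_true, if_false]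
        exact div_nonneg (by linarith) (by linarith)
      · simp only [if_true]
        exact div_nonneg (by linarith) (by linarith)
    · refine ih _ _ ?_ ?_
      · rw [QueryProcess.toFinset_append_singleton]
        exact hT.step (by simpa using hi) (Finset.mem_univ _)
      · simp [List.nodup_append, hn]
        exact fun a ha h => hi (h ▸ ha)
    · simp only [knapsackProcess, hcard, Fintype.sum_bool, if_true, Bool.false_eq_true, if_false]
      ring

lemma ev_X (e : (knapsack n k).edges) :
    (knapsackProcess n k).ev ∅ ∅ (X e : (knapsack n k).Poly) = k / n := by
  obtain ⟨i, hi⟩ := Finset.card_eq_one.1 (Finset.mem_powersetCard_univ.1 e.2)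
  have hT : (knapsackProcess n k).Reach ∅ ∅ := .init
  have h : ∀ o, (knapsackProcess n k).ev (insert i ∅) ((knapsackProcess n k).next ∅ i o)
      (X e : (knapsack n k).Poly) = if o then 1 else 0 := fun o => by
    rw [laws.ev_of_mem_polysOn (hT.step (Finset.notMem_empty i) (Finset.mem_univ o))
      (X_mem_polysOn (by simp [hi]))]
    cases o <;> simp [knapsackProcess, hi]
  rw [laws.ev_step hT (Finset.notMem_empty i), QueryProcess.step]
  simp only [h]
  simp [knapsackProcess]

lemma eqs_cases {s : (knapsack n k).Poly} (hs : s ∈ (knapsack n k).eqs) :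
    (∃ e : (knapsack n k).edges, s = X e ^ 2 - X e) ∨ s = ∑ e, X e - C k := hs

lemma isSymmetricOutside_sum (A : Finset (Fin n)) :
    (knapsack n k).IsSymmetricOutside A (∑ e, X e - C k) := by
  intro σ _
  simp only [permPoly, map_sub, map_sum, rename_X, rename_C]
  congr 1
  exact Equiv.sum_comp (permSubsets σ) (fun e => (X e : MvPolynomial (tSubsets n 1) ℝ))

/-- As `R < n`, some variable lies outside `A`, so the capacity equation keeps index degree one and
a vertex of `A'ᶜ` remains. The expectation then equals the initial one, `n * (k / n) - k = 0`. With
everything revealed it could fail, as the number of elements taken need not be `k`. -/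
lemma satisfiesEqs {R : ℕ} (hR : R < n) : (knapsackProcess n k).SatisfiesEqs R := by
  intro A hA s hs A' T hT _ hd
  rcases eqs_cases hs with ⟨e, rfl⟩ | rfl
  · exact laws.ev_X_sq_sub_X (fun T e => (ite_eq_or_eq _ _ _).symm) hT e
  · have hlow : (knapsack n k).indexDeg ∅ (∑ e, X e - C k) ≤ 1 := by
      refine Submodule.sub_mem ((knapsack n k).lowIndexDeg ∅ 1)
        (Submodule.sum_mem _ fun e _ => ?_) (C_mem_lowIndexDeg _ _ _)
      exact mem_lowIndexDeg_of_mem_polysOn (X_mem_polysOn le_rfl) _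
        (Finset.mem_powersetCard_univ.1 e.2).le
    obtain ⟨i, hi⟩ : Aᶜ.Nonempty := by
      rw [← Finset.card_pos, Finset.card_compl, Fintype.card_fin]; lia
    let e : (knapsack n k).edges := ⟨{i}, by simp [knapsack]⟩
    have hup : 1 ≤ (knapsack n k).indexDeg A (∑ e, X e - C k) := by
      refine le_trans ?_ (le_indexDeg (m := Finsupp.single e 1)
        (by rw [coeff_sum_X_sub_C _ (Finset.mem_univ _)]; exact one_ne_zero) A)
      rw [indices_single, Finset.sdiff_eq_self_of_disjoint (by simpa [e] using hi)]
      simp [e]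
    have hT₀ : (knapsackProcess n k).Reach ∅ ∅ := .init
    rw [laws.ev_eq_init (isSymmetricOutside_sum ∅) hT (by lia)]
    change (knapsackProcess n k).ev ∅ ∅ _ = 0
    have hn : 0 < n := by lia
    have hn' : (n : ℝ) ≠ 0 := by positivity
    rw [laws.ev_sub hT₀, laws.ev_sum hT₀, laws.ev_C hT₀]
    simp only [ev_X]
    have hcard : Fintype.card (knapsack n k).edges = n :=
      (card_tSubsets n 1).trans (Nat.choose_one_right n)
    rw [Finset.sum_const, nsmul_eq_mul, Finset.card_univ, hcard]
    field_simp
    ring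

end knapsackProcess

theorem knapsackStory_isGoodStory {n : ℕ} {k : ℝ} (hn : 2 ≤ n) (hk : 0 ≤ k) (hkn : k ≤ n)
    (hnk : ¬(n = 2 ∧ k = 1)) :
    Strategy.IsGoodStory (⌊min k ((n : ℝ) - k)⌋₊ + 1) n (knapsackStory n k) := by
  have hlt : ⌊min k ((n : ℝ) - k)⌋₊ + 1 < n := by
    have h0 : 0 ≤ min k ((n : ℝ) - k) := le_min hk (by linarith)
    by_contra! hle
    -- Adding `n - 1 ≤ k` and `n - 1 ≤ n - k` gives `n ≤ 2`, which leaves just the excluded case `n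
    -- = 2`, `k = 1`.
    have h1 : ((n : ℝ) - 1) ≤ min k ((n : ℝ) - k) := by
      refine le_trans ?_ (Nat.floor_le h0)
      have : (n : ℝ) ≤ (⌊min k ((n : ℝ) - k)⌋₊ + 1 : ℕ) := by exact_mod_cast hle
      push_cast at this
      linarith
    have h2 := h1.trans (min_le_left _ _)
    have h3 := h1.trans (min_le_right _ _)
    have h4 : (n : ℝ) ≤ 2 := by linarith
    have h5 : n = 2 := le_antisymm (by exact_mod_cast h4) hn
    subst h5
    norm_num at h2 h3
    exact hnk ⟨rfl, by linarith⟩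
  exact knapsackProcess.laws.isGoodStory (knapsackProcess.satisfiesEqs hlt) _
    (knapsackProcess.realizes le_rfl hk hkn n [] ∅ .init List.nodup_nil) .init List.nodup_nil
    (by simp) (by simp)

/-! ### The MOD 2 principle -/

/-- The vertices of `A` which are in no edge of `M`. -/
def unmatchedIn {n : ℕ} (A : Finset (Fin n)) (M : Finset (Finset (Fin n))) : Finset (Fin n) :=
  A.filter fun v => ∀ e ∈ M, v ∉ e

/-- The process which reveals a perfect matching. -/
noncomputable def modTwoProcess (n : ℕ) :
    QueryProcess (modTwo n) (Finset (Finset (Fin n))) (Option (Fin n)) where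
  outcomes A M := (unmatchedIn A M).insertNone
  weight A M o := match o with
    | some _ => 1
    | none => (n : ℝ) - A.card - (unmatchedIn A M).card
  next M i o := match o with
    | some v => insert {v, i} M
    | none => M
  init := ∅
  act σ M := M.map (Finset.mapEmbedding σ.toEmbedding).toEmbedding
  val M e := if e.1 ∈ M then 1 else 0

namespace modTwoProcess

variable {n : ℕ}

lemma step_eq (A : Finset (Fin n)) (M : Finset (Finset (Fin n))) (i : Fin n)
    (φ : Finset (Finset (Fin n)) → ℝ) :
    (modTwoProcess n).step A M i φ = ∑ v ∈ unmatchedIn A M, φ (insert {v, i} M) +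
      ((n : ℝ) - A.card - (unmatchedIn A M).card) * φ M := by
  simp [QueryProcess.step, modTwoProcess, Finset.sum_insertNone, add_comm]

lemma next_some (M : Finset (Finset (Fin n))) (i v : Fin n) :
    (modTwoProcess n).next M i (some v) = insert {v, i} M := rfl

lemma next_none (M : Finset (Finset (Fin n))) (i : Fin n) :
    (modTwoProcess n).next M i none = M := rfl

lemma act_eq (σ : Equiv.Perm (Fin n)) (M : Finset (Finset (Fin n))) :
    (modTwoProcess n).act σ M = M.map (Finset.mapEmbedding σ.toEmbedding).toEmbedding := rfl

lemma some_mem_outcomes {A : Finset (Fin n)} {M : Finset (Finset (Fin n))} {v : Fin n} :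
    some v ∈ (modTwoProcess n).outcomes A M ↔ v ∈ unmatchedIn A M :=
  Finset.some_mem_insertNone

lemma none_mem_outcomes {A : Finset (Fin n)} {M : Finset (Finset (Fin n))} :
    none ∈ (modTwoProcess n).outcomes A M := Finset.none_mem_insertNone

lemma mem_unmatchedIn {A : Finset (Fin n)} {M : Finset (Finset (Fin n))} {v : Fin n} :
    v ∈ unmatchedIn A M ↔ v ∈ A ∧ ∀ e ∈ M, v ∉ e := Finset.mem_filter

/-- In a reachable state, `M` is a matching of vertices of `A`. -/
lemma matching_of_reach {A : Finset (Fin n)} {M : Finset (Finset (Fin n))}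
    (h : (modTwoProcess n).Reach A M) : (∀ e ∈ M, e ⊆ A) ∧ (∀ e ∈ M, e.card = 2) ∧
      ∀ e ∈ M, ∀ e' ∈ M, ∀ v, v ∈ e → v ∈ e' → e = e' := by
  induction h with
  | init => simp [modTwoProcess]
  | @step A M i o hT hi ho ih =>
    obtain ⟨h₁, h₂, h₃⟩ := ih
    cases o with
    | none => exact ⟨fun e he => (h₁ e he).trans (Finset.subset_insert _ _), h₂, h₃⟩
    | some v =>
      obtain ⟨hv, hvM⟩ := mem_unmatchedIn.1 (some_mem_outcomes.1 ho)
      have hvi : v ≠ i := fun h => hi (h ▸ hv)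
      have hiM : ∀ e ∈ M, i ∉ e := fun e he h => hi (h₁ e he h)
      have key : ∀ e ∈ M, ∀ w, w ∈ e → w ∉ ({v, i} : Finset (Fin n)) := fun e he w hw hw' => by
        rcases Finset.mem_insert.1 hw' with rfl | h
        · exact hvM e he hw
        · exact hiM e he (Finset.mem_singleton.1 h ▸ hw)
      simp only [next_some]
      refine ⟨?_, ?_, ?_⟩
      · intro e he
        rcases Finset.mem_insert.1 he with rfl | he
        · intro w hw
          simp only [Finset.mem_insert, Finset.mem_singleton] at hw ⊢
          rcases hw with rfl | rfl
          · exact Or.inr hv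
          · exact Or.inl rfl
        · exact (h₁ e he).trans (Finset.subset_insert _ _)
      · intro e he
        rcases Finset.mem_insert.1 he with rfl | he
        · exact Finset.card_pair hvi
        · exact h₂ e he
      · intro e he e' he' w hw hw'
        rcases Finset.mem_insert.1 he with rfl | he <;>
          rcases Finset.mem_insert.1 he' with rfl | he'
        · rfl
        · exact absurd hw (key e' he' w hw')
        · exact absurd hw' (key e he w hw)
        · exact h₃ e he e' he' w hw hw'

section

variable {A : Finset (Fin n)} {M : Finset (Finset (Fin n))} {i : Fin n}

lemma notMem_of_reach (hT : (modTwoProcess n).Reach A M) (hi : i ∉ A) : ∀ e ∈ M, i ∉ e :=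
  fun e he h => hi ((matching_of_reach hT).1 e he h)

lemma unmatchedIn_none (hT : (modTwoProcess n).Reach A M) (hi : i ∉ A) :
    unmatchedIn (insert i A) M = insert i (unmatchedIn A M) := by
  rw [unmatchedIn, Finset.filter_insert, if_pos (notMem_of_reach hT hi)]
  rfl

lemma unmatchedIn_some (hi : i ∉ A) (v : Fin n) :
    unmatchedIn (insert i A) (insert {v, i} M) = (unmatchedIn A M).erase v := by
  ext w
  simp only [mem_unmatchedIn, Finset.mem_insert, Finset.mem_erase, forall_eq_or_imp,
    Finset.mem_singleton]
  constructor
  · rintro ⟨h | h, h', h''⟩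
    · exact absurd (Or.inr h) h'
    · exact ⟨fun h => h' (Or.inl h), h, h''⟩
  · rintro ⟨h, h', h''⟩
    exact ⟨Or.inr h', fun h3 => h3.elim h fun h4 => hi (h4 ▸ h'), h''⟩

lemma notMem_unmatchedIn (hi : i ∉ A) : i ∉ unmatchedIn A M := fun h =>
  hi (mem_unmatchedIn.1 h).1

/-- The weight of staying unmatched drops by two, as both `A` and its set of unmatched vertices
grow; one unit reappears as the possibility of matching `j` to `i`. -/
lemma step_none (hT : (modTwoProcess n).Reach A M) (hi : i ∉ A) (j : Fin n)
    (φ : Finset (Finset (Fin n)) → ℝ) :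
    (modTwoProcess n).step (insert i A) M j φ =
      φ (insert {i, j} M) + ∑ v ∈ unmatchedIn A M, φ (insert {v, j} M) +
      ((n : ℝ) - A.card - (unmatchedIn A M).card - 2) * φ M := by
  rw [step_eq, unmatchedIn_none hT hi, Finset.sum_insert (notMem_unmatchedIn hi),
    Finset.card_insert_of_notMem hi, Finset.card_insert_of_notMem (notMem_unmatchedIn hi)]
  push_cast
  ring

/-- Here `A` grows while the set of unmatched vertices shrinks, so the weight of staying unmatched
does not change. -/
lemma step_some (hi : i ∉ A) {v : Fin n} (hv : v ∈ unmatchedIn A M) (j : Fin n)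
    (φ : Finset (Finset (Fin n)) → ℝ) :
    (modTwoProcess n).step (insert i A) (insert {v, i} M) j φ =
      ∑ w ∈ (unmatchedIn A M).erase v, φ (insert {w, j} (insert {v, i} M)) +
      ((n : ℝ) - A.card - (unmatchedIn A M).card) * φ (insert {v, i} M) := by
  rw [step_eq, unmatchedIn_some hi, Finset.card_insert_of_notMem hi,
    ← Finset.card_erase_add_one hv]
  push_cast
  ring

end

/-- The right side is visibly symmetric in `i` and `j`, up to the order of the double sum and of
insertions, which yields `step_comm`. -/
lemma step_step {A : Finset (Fin n)} {M : Finset (Finset (Fin n))}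
    (hT : (modTwoProcess n).Reach A M) {i : Fin n} (hi : i ∉ A) (j : Fin n)
    (φ : Finset (Finset (Fin n)) → ℝ) :
    (modTwoProcess n).step A M i (fun M' => (modTwoProcess n).step (insert i A) M' j φ) =
      ∑ v ∈ unmatchedIn A M, ∑ w ∈ (unmatchedIn A M).erase v,
        φ (insert {w, j} (insert {v, i} M)) +
      ((n : ℝ) - A.card - (unmatchedIn A M).card) *
        (∑ v ∈ unmatchedIn A M, φ (insert {v, i} M) + ∑ v ∈ unmatchedIn A M, φ (insert {v, j} M) +
        φ (insert {i, j} M) + ((n : ℝ) - A.card - (unmatchedIn A M).card - 2) * φ M) := by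
  rw [step_eq, step_none hT hi, Finset.sum_congr rfl fun v hv => step_some hi hv j φ,
    Finset.sum_add_distrib, ← Finset.mul_sum]
  ring

lemma unmatchedIn_map (σ : Equiv.Perm (Fin n)) (A : Finset (Fin n))
    (M : Finset (Finset (Fin n))) :
    unmatchedIn (A.map σ.toEmbedding) ((modTwoProcess n).act σ M) =
      (unmatchedIn A M).map σ.toEmbedding := by
  ext w
  obtain ⟨v, rfl⟩ := σ.surjective w
  simp [mem_unmatchedIn, act_eq]

lemma act_insert (σ : Equiv.Perm (Fin n)) (v i : Fin n) (M : Finset (Finset (Fin n))) :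
    (modTwoProcess n).act σ (insert {v, i} M) =
      insert {σ v, σ i} ((modTwoProcess n).act σ M) := by
  simp [act_eq, Finset.map_insert, Finset.mapEmbedding_apply]

lemma laws : (modTwoProcess n).Laws where
  sum_weight {A M} _ := by
    simp [modTwoProcess, Finset.sum_insertNone]
  step_comm {A M} hT {i j} hi hj hij φ := by
    have hcomm : ∑ v ∈ unmatchedIn A M, ∑ w ∈ (unmatchedIn A M).erase v,
          φ (insert {w, j} (insert {v, i} M)) =
        ∑ w ∈ unmatchedIn A M, ∑ v ∈ (unmatchedIn A M).erase w,
          φ (insert {w, j} (insert {v, i} M)) :=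
      Finset.sum_comm' fun v w => by
        simp only [Finset.mem_erase]
        tauto
    rw [step_step hT hi, step_step hT hj, Finset.pair_comm i j, hcomm]
    simp only [Finset.insert_comm {_, j} {_, i} M]
    ring
  step_remove {A M} hT {i j} hi hj hij {o} ho φ ψ h := by
    have hnn := h none none_mem_outcomes none none_mem_outcomes
    have hns : ∀ w ∈ insert j (unmatchedIn A M), ψ (insert {w, i} M) = φ M := fun w hw =>
      h none none_mem_outcomes (some w)
        (by rw [some_mem_outcomes, next_none, unmatchedIn_none hT hj]; exact hw)
    have hsn : ∀ v ∈ unmatchedIn A M, ψ (insert {v, j} M) = φ (insert {v, j} M) := fun v hv =>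
      h (some v) (some_mem_outcomes.2 hv) none none_mem_outcomes
    have hss : ∀ v ∈ unmatchedIn A M, ∀ w ∈ (unmatchedIn A M).erase v,
        ψ (insert {w, i} (insert {v, j} M)) = φ (insert {v, j} M) := fun v hv w hw =>
      h (some v) (some_mem_outcomes.2 hv) (some w)
        (by rw [some_mem_outcomes, next_some, unmatchedIn_some hj]; exact hw)
    simp only [next_none] at hnn
    cases o with
    -- Forgetting `i`, the states where `j` is matched to `i` and where `j` stays unmatched
    -- coincide; their weights change by `+1` and `-2`.
    | none =>
      rw [next_none, next_none, step_none hT hi, step_eq, hnn, Finset.sum_congr rfl hsn,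
        Finset.pair_comm i j, hns j (Finset.mem_insert_self _ _)]
      ring
    -- The partner `v` is no longer available to `j`; its lost unit of weight is the correction
    -- term.
    | some v =>
      have hv := some_mem_outcomes.1 ho
      rw [next_some, next_some, step_some hi hv, step_eq, hns v (Finset.mem_insert_of_mem hv),
        ← Finset.sum_erase_add _ _ hv, Finset.sum_congr rfl fun w hw => ?_]
      · ring
      · rw [Finset.insert_comm]
        have hw' := Finset.mem_erase.1 hw
        exact hss w hw'.2 v (Finset.mem_erase.2 ⟨hw'.1.symm, hv⟩)
  step_act {A M} _ {i} _ σ φ := by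
    simp only [step_eq, unmatchedIn_map, Finset.card_map, Finset.sum_map, act_insert]
    rfl
  act_init σ := rfl
  act_next {A M} hT {i} _ {o} ho σ hσ := by
    have h : (modTwoProcess n).act σ M = M := by
      rw [act_eq]
      refine (Finset.eq_of_subset_of_card_le (fun e he => Finset.mem_map.2 ⟨e, he, ?_⟩)
        (by simp)).symm
      exact QueryProcess.map_eq_of_fix fun a ha => hσ a ((matching_of_reach hT).1 e he ha)
    cases o with
    | none => exact h
    | some v =>
      rw [next_some, next_some, act_insert, h,
        hσ v (mem_unmatchedIn.1 (some_mem_outcomes.1 ho)).1]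
  val_next {A M} hT {i} hi {o} ho e he := by
    cases o with
    | none => rfl
    | some v =>
      have : e.1 ≠ {v, i} := fun h => hi (he (by simp [h]))
      simp [modTwoProcess, this]
  val_act σ M e := by
    have : (Finset.map σ.toEmbedding e.1 ∈ M.map (Finset.mapEmbedding σ.toEmbedding).toEmbedding) ↔
        e.1 ∈ M := Finset.mem_map' (Finset.mapEmbedding σ.toEmbedding).toEmbedding
    simp only [modTwoProcess, permEdge, this]

lemma realizes (d : ℕ) :
    ∀ (A : List (Fin n)) (M : Finset (Finset (Fin n))), (modTwoProcess n).Reach A.toFinset M →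
      A.Nodup → (modTwoProcess n).Realizes (n / 2 + 1) (modTwoStoryFrom n d A M) M := by
  induction d with
  | zero => exact fun _ _ _ _ => rfl
  | succ d ih =>
    intro A M hT hn
    have hcard : A.toFinset.card = A.length := List.toFinset_card_of_nodup hn
    have hmem : ∀ o : Option (unmatched A M),
        o.map Subtype.val ∈ (modTwoProcess n).outcomes A.toFinset M := fun o =>
      match o with
      | none => none_mem_outcomes
      | some v => some_mem_outcomes.2 v.2
    refine ⟨rfl, fun i hi => ⟨Option.map Subtype.val, hmem, fun o ho => ?_, fun o => ?_,
      fun φ => ?_⟩⟩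
    · have hle : 2 * (A.length : ℝ) ≤ n := by
        exact_mod_cast (show 2 * A.length ≤ n by lia)
      have hu : ((unmatched A M).card : ℝ) ≤ A.length := by
        rw [← hcard]; exact_mod_cast Finset.card_le_card (Finset.filter_subset _ _)
      have h0 : (0 : ℝ) ≤ A.length := Nat.cast_nonneg _
      cases o with
      | none => exact div_nonneg (by linarith) (by linarith)
      | some v => exact div_nonneg zero_le_one (by linarith)
    · have hreach := hT.step (by simpa using hi) (hmem o)
      rw [← QueryProcess.toFinset_append_singleton] at hreach
      have hnd : (A ++ [i]).Nodup := by
        simp [List.nodup_append, hn]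
        exact fun a ha h => hi (h ▸ ha)
      cases o with
      | none => exact ih _ _ hreach hnd
      | some v => exact ih _ _ hreach hnd
    · have h := Finset.sum_coe_sort (unmatched A M) fun v => φ (some v)
      have hU : unmatchedIn A.toFinset M = unmatched A M := rfl
      simp only [modTwoProcess, Finset.sum_insertNone, hcard, hU, Fintype.sum_option,
        Option.map_some, Option.map_none, one_div, one_mul, ← Finset.mul_sum, h]
      ring

/-! ### The vertex equations of the MOD 2 principle -/

lemma sum_edges_containing (i : Fin n) (F : Finset (Fin n) → ℝ) :
    ∑ e : tSubsets n 2 with i ∈ e.1, F e.1 = ∑ j ∈ Finset.univ.erase i, F {i, j} := by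
  symm
  refine Finset.sum_bij (fun j hj => ⟨{i, j}, by
      rw [Finset.mem_powersetCard_univ]
      exact Finset.card_pair (Finset.ne_of_mem_erase hj).symm⟩)
    (fun j hj => by simp) (fun j hj j' hj' h => ?_) (fun e he => ?_) (fun j hj => rfl)
  · have h' : ({i, j} : Finset (Fin n)) = {i, j'} := congrArg Subtype.val h
    have : j ∈ ({i, j'} : Finset (Fin n)) := h' ▸ by simp
    simpa [Finset.ne_of_mem_erase hj] using this
  · have hi : i ∈ e.1 := (Finset.mem_filter.1 he).2
    have hc : (e.1.erase i).card = 1 := by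
      rw [Finset.card_erase_of_mem hi, Finset.mem_powersetCard_univ.1 e.2]
    obtain ⟨j, hj⟩ := Finset.card_eq_one.1 hc
    have hji : j ≠ i := Finset.ne_of_mem_erase (hj ▸ Finset.mem_singleton_self j)
    refine ⟨j, by simp [hji], Subtype.ext ?_⟩
    change {i, j} = e.1
    rw [← Finset.insert_erase hi, hj]

/-- If the other endpoint is unrevealed, reveal it next: it picks `i` with probability `1 / (n -
|A|)` when `i` is free, and cannot pick it otherwise. -/
lemma ev_X {A : Finset (Fin n)} {M : Finset (Finset (Fin n))}
    (hT : (modTwoProcess n).Reach A M) {i : Fin n} (hi : i ∈ A) (e : (modTwo n).edges)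
    (hie : i ∈ e.1) : (modTwoProcess n).ev A M (X e) =
      if e.1 ⊆ A then (if e.1 ∈ M then 1 else 0)
      else (if i ∈ unmatchedIn A M then 1 else 0) / ((n : ℝ) - A.card) := by
  split_ifs with h hM hU
  · rw [laws.ev_of_mem_polysOn hT (X_mem_polysOn h), aeval_X]
    exact if_pos hM
  · rw [laws.ev_of_mem_polysOn hT (X_mem_polysOn h), aeval_X]
    exact if_neg hM
  all_goals
    obtain ⟨j, hj, hjA⟩ := Finset.not_subset.1 h
    have hij : i ≠ j := fun h => hjA (h ▸ hi)
    have he : e.1 = {i, j} := by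
      refine (Finset.eq_of_subset_of_card_le ?_ ?_).symm
      · simp [Finset.insert_subset_iff, hie, hj]
      · rw [Finset.card_pair hij, Finset.mem_powersetCard_univ.1 e.2]
    have hpoly : (X e : (modTwo n).Poly) ∈ (modTwo n).polysOn (insert j A) :=
      X_mem_polysOn (by rw [he]; simp [Finset.insert_subset_iff, hi])
    have heM : e.1 ∉ M := fun h => hjA ((matching_of_reach hT).1 _ h hj)
    have hnext : ∀ o ∈ (modTwoProcess n).outcomes A M,
        (modTwoProcess n).ev (insert j A) ((modTwoProcess n).next M j o) (X e) =
          (modTwoProcess n).val ((modTwoProcess n).next M j o) e := fun o ho => by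
      rw [laws.ev_of_mem_polysOn (hT.step hjA ho) hpoly, aeval_X]
    rw [laws.ev_step hT hjA, QueryProcess.step_congr (ψ := fun M' => (modTwoProcess n).val M' e) hnext, step_eq]
    have hval : ∀ v ∈ unmatchedIn A M,
        (modTwoProcess n).val (insert {v, j} M) e = if v = i then 1 else 0 := fun v hv => by
      have : e.1 ∈ insert {v, j} M ↔ v = i := by
        rw [Finset.mem_insert, or_iff_left heM, he]
        constructor
        · intro h
          have : i ∈ ({v, j} : Finset (Fin n)) := h ▸ by simp
          simpa [hij, eq_comm] using this
        · rintro rfl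
          rfl
      simp [modTwoProcess, this]
    have hval' : (modTwoProcess n).val M e = 0 := if_neg heM
    rw [Finset.sum_congr rfl hval, hval', Finset.sum_ite_eq']
    simp [hU]

/-- The polynomial which states that `i` is matched exactly once. -/
noncomputable def vertexEq (i : Fin n) : (modTwo n).Poly :=
  ∑ e : (modTwo n).edges with i ∈ e.1, X e - C 1

lemma eqs_cases {s : (modTwo n).Poly} (hs : s ∈ (modTwo n).eqs) :
    (∃ e : (modTwo n).edges, s = X e ^ 2 - X e) ∨ ∃ i, s = vertexEq i := by
  obtain h | ⟨i, h⟩ := hs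
  · exact Or.inl h
  · exact Or.inr ⟨i, by rw [vertexEq, C_1]; exact h⟩

/-- If `i` is unmatched, the `n - |A|` unrevealed vertices contribute `1 / (n - |A|)` each; this
needs one such vertex. If `i` is matched, its unique partner in `A` contributes the 1. -/
lemma ev_vertexEq_of_mem {A : Finset (Fin n)} {M : Finset (Finset (Fin n))}
    (hT : (modTwoProcess n).Reach A M) {i : Fin n} (hi : i ∈ A) (hA : A.card < n) :
    (modTwoProcess n).ev A M (vertexEq i) = 0 := by
  have hN : (n : ℝ) - A.card ≠ 0 := by
    have : (A.card : ℝ) < n := by exact_mod_cast hA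
    linarith
  obtain ⟨hM₁, hM₂, hM₃⟩ := matching_of_reach hT
  rw [vertexEq, laws.ev_sub hT, laws.ev_sum hT, laws.ev_C hT,
    Finset.sum_congr rfl fun e he => ev_X hT hi e (Finset.mem_filter.1 he).2]
  have key := sum_edges_containing i fun e => if e ⊆ A then (if e ∈ M then (1 : ℝ) else 0)
      else (if i ∈ unmatchedIn A M then 1 else 0) / ((n : ℝ) - A.card)
  refine sub_eq_zero.2 (Eq.trans key ?_)
  have hsplit : (Finset.univ.erase i : Finset (Fin n)) = A.erase i ∪ Aᶜ := by
    ext v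
    by_cases hv : v = i <;> by_cases hvA : v ∈ A <;> simp_all
  have hdisj : Disjoint (A.erase i) Aᶜ :=
    Finset.disjoint_left.2 fun v hv hv' => (Finset.mem_compl.1 hv') (Finset.mem_of_mem_erase hv)
  rw [hsplit, Finset.sum_union hdisj]
  have h₁ : ∀ j ∈ Aᶜ, (if {i, j} ⊆ A then (if {i, j} ∈ M then (1 : ℝ) else 0)
      else (if i ∈ unmatchedIn A M then 1 else 0) / ((n : ℝ) - A.card)) =
      (if i ∈ unmatchedIn A M then 1 else 0) / ((n : ℝ) - A.card) := fun j hj =>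
    if_neg fun h => Finset.mem_compl.1 hj (h (by simp))
  have h₂ : ∀ j ∈ A.erase i, (if {i, j} ⊆ A then (if {i, j} ∈ M then (1 : ℝ) else 0)
      else (if i ∈ unmatchedIn A M then 1 else 0) / ((n : ℝ) - A.card)) =
      if {i, j} ∈ M then 1 else 0 := fun j hj =>
    if_pos (by simp [Finset.insert_subset_iff, hi, Finset.mem_of_mem_erase hj])
  rw [Finset.sum_congr rfl h₁, Finset.sum_congr rfl h₂, Finset.sum_const, nsmul_eq_mul,
    Finset.card_compl, Fintype.card_fin, Nat.cast_sub hA.le, mul_div_cancel₀ _ hN]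
  split_ifs with hU
  · rw [Finset.sum_eq_zero, zero_add]
    exact fun j _ => if_neg fun h => (mem_unmatchedIn.1 hU).2 _ h (by simp)
  · obtain ⟨e, he, hie⟩ : ∃ e ∈ M, i ∈ e := by
      by_contra! h
      exact hU (mem_unmatchedIn.2 ⟨hi, h⟩)
    have hc : (e.erase i).card = 1 := by
      rw [Finset.card_erase_of_mem hie, hM₂ e he]
    obtain ⟨j, hj⟩ := Finset.card_eq_one.1 hc
    have hje : j ∈ e.erase i := hj ▸ Finset.mem_singleton_self j
    have heq : e = {i, j} := by rw [← Finset.insert_erase hie, hj]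
    rw [add_zero, Finset.sum_eq_single j]
    · rw [if_pos (heq ▸ he)]
    · intro j' hj' hne
      refine if_neg fun h => hne ?_
      have h' := hM₃ _ h e he i (by simp) hie
      have : j' ∈ e.erase i := Finset.mem_erase.2 ⟨Finset.ne_of_mem_erase hj', h' ▸ by simp⟩
      rw [hj] at this
      exact Finset.mem_singleton.1 this
    · exact fun h => absurd (Finset.mem_erase.2
        ⟨Finset.ne_of_mem_erase hje, hM₁ e he (Finset.mem_of_mem_erase hje)⟩) h

lemma ev_vertexEq_of_notMem {A : Finset (Fin n)} {M : Finset (Finset (Fin n))}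
    (hT : (modTwoProcess n).Reach A M) {i : Fin n} (hi : i ∉ A) (hA : A.card + 1 < n) :
    (modTwoProcess n).ev A M (vertexEq i) = 0 := by
  rw [laws.ev_step hT hi, QueryProcess.step_congr (ψ := fun _ => 0), laws.step_const hT]
  · simp
  · exact fun o ho => ev_vertexEq_of_mem (hT.step hi ho) (Finset.mem_insert_self _ _)
      (by rwa [Finset.card_insert_of_notMem hi])

lemma card_sdiff_le_indexDeg_vertexEq {i j : Fin n} (hij : i ≠ j) (A : Finset (Fin n)) :
    (({i, j} : Finset (Fin n)) \ A).card ≤ (modTwo n).indexDeg A (vertexEq i) := by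
  let e : (modTwo n).edges := ⟨{i, j}, Finset.mem_powersetCard_univ.2 (Finset.card_pair hij)⟩
  have h := le_indexDeg (m := Finsupp.single e 1) (f := vertexEq i)
    (by rw [vertexEq, coeff_sum_X_sub_C _ (by simp [e])]; exact one_ne_zero) A
  rwa [indices_single] at h

/-- A vertex `j ≠ i` outside `A` exists. If `i` is revealed, the variable of `{i, j}` forces one
unrevealed vertex. If not, it forces two, and one remains after revealing `i`. -/
lemma satisfiesEqs {R : ℕ} (hR : R + 2 ≤ n) : (modTwoProcess n).SatisfiesEqs R := by
  intro A hA s hs A' T hT hAA' hd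
  rcases eqs_cases hs with ⟨e, rfl⟩ | ⟨i, rfl⟩
  · exact laws.ev_X_sq_sub_X (fun T e => (ite_eq_or_eq _ _ _).symm) hT e
  · obtain ⟨j, hj⟩ : (Aᶜ.erase i).Nonempty := by
      have := Finset.pred_card_le_card_erase (s := Aᶜ) (a := i)
      rw [Finset.card_compl, Fintype.card_fin] at this
      rw [← Finset.card_pos]; lia
    obtain ⟨hji, hjA⟩ : j ≠ i ∧ j ∉ A := by simpa using hj
    have hle := card_sdiff_le_indexDeg_vertexEq hji.symm A
    by_cases hi : i ∈ A'
    · refine ev_vertexEq_of_mem hT hi ?_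
      have : 1 ≤ (({i, j} : Finset (Fin n)) \ A).card :=
        Finset.card_pos.2 ⟨j, by simp [hjA]⟩
      lia
    · refine ev_vertexEq_of_notMem hT hi ?_
      have hiA : i ∉ A := fun h => hi (hAA' h)
      rw [Finset.sdiff_eq_self_of_disjoint (by simp [hiA, hjA]), Finset.card_pair hji.symm] at hle
      lia

end modTwoProcess

theorem modTwoStory_isGoodStory {n : ℕ} (hn : 5 ≤ n) :
    Strategy.IsGoodStory (n / 2 + 1) n (modTwoStory n) :=
  -- The side condition is `n / 2 + 1 + 2 ≤ n`, which holds exactly from `n = 5` on.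
  modTwoProcess.laws.isGoodStory (modTwoProcess.satisfiesEqs (by lia)) _
    (modTwoProcess.realizes n [] ∅ .init List.nodup_nil) .init List.nodup_nil (by simp) (by simp)

/-! ### The triangle problem -/

/-- The process which reveals a partition into independent sets of size `q`. -/
noncomputable def triangleProcess (n : ℕ) (q ρ : ℝ) :
    QueryProcess (triangleProblem n ρ) (Finset (Finset (Fin n))) (Option (Finset (Fin n))) where
  outcomes _ F := F.insertNone
  weight _ F o := match o with
    | some B => q - B.card
    | none => (n : ℝ) - F.card * q
  next F i o := match o with
    | some B => insert (insert i B) (F.erase B)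
    | none => insert {i} F
  init := ∅
  act σ F := F.map (Finset.mapEmbedding σ.toEmbedding).toEmbedding
  val F e := if ∃ B ∈ F, e.1 ⊆ B then 0 else 1

namespace triangleProcess

variable {n : ℕ} {q ρ : ℝ}

lemma step_eq (A : Finset (Fin n)) (F : Finset (Finset (Fin n))) (i : Fin n)
    (φ : Finset (Finset (Fin n)) → ℝ) :
    (triangleProcess n q ρ).step A F i φ =
      ∑ B ∈ F, (q - B.card) * φ (insert (insert i B) (F.erase B)) +
      ((n : ℝ) - F.card * q) * φ (insert {i} F) := by
  simp [QueryProcess.step, triangleProcess, Finset.sum_insertNone, add_comm]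

lemma next_some (F : Finset (Finset (Fin n))) (i : Fin n) (B : Finset (Fin n)) :
    (triangleProcess n q ρ).next F i (some B) = insert (insert i B) (F.erase B) := rfl

lemma next_none (F : Finset (Finset (Fin n))) (i : Fin n) :
    (triangleProcess n q ρ).next F i none = insert {i} F := rfl

lemma act_eq (σ : Equiv.Perm (Fin n)) (F : Finset (Finset (Fin n))) :
    (triangleProcess n q ρ).act σ F =
      F.map (Finset.mapEmbedding σ.toEmbedding).toEmbedding := rfl

lemma some_mem_outcomes {A B : Finset (Fin n)} {F : Finset (Finset (Fin n))} :
    some B ∈ (triangleProcess n q ρ).outcomes A F ↔ B ∈ F :=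
  Finset.some_mem_insertNone

lemma none_mem_outcomes {A : Finset (Fin n)} {F : Finset (Finset (Fin n))} :
    none ∈ (triangleProcess n q ρ).outcomes A F := Finset.none_mem_insertNone

lemma insert_notMem_erase {F : Finset (Finset (Fin n))} {i : Fin n} (hi : ∀ B ∈ F, i ∉ B)
    (B : Finset (Fin n)) : insert i B ∉ F.erase B := fun h =>
  hi _ (Finset.mem_of_mem_erase h) (Finset.mem_insert_self _ _)

lemma singleton_notMem {F : Finset (Finset (Fin n))} {i : Fin n} (hi : ∀ B ∈ F, i ∉ B) :
    {i} ∉ F := fun h => hi _ h (Finset.mem_singleton_self _)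

/-- The parts of a reachable state lie in `A`, their sizes add up to `|A|`, and there are at most
`|A|` parts. -/
lemma partition_of_reach {A : Finset (Fin n)} {F : Finset (Finset (Fin n))}
    (h : (triangleProcess n q ρ).Reach A F) : (∀ B ∈ F, B ⊆ A) ∧
      ∑ B ∈ F, B.card = A.card ∧ F.card ≤ A.card := by
  induction h with
  | init => simp [triangleProcess]
  | @step A F i o hT hi ho ih =>
    obtain ⟨h₁, h₂, h₃⟩ := ih
    have hiF : ∀ B ∈ F, i ∉ B := fun B hB h => hi (h₁ B hB h)
    rw [Finset.card_insert_of_notMem hi]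
    cases o with
    | none =>
      rw [next_none, Finset.sum_insert (singleton_notMem hiF),
        Finset.card_insert_of_notMem (singleton_notMem hiF), Finset.card_singleton]
      refine ⟨fun B hB => ?_, by lia, by lia⟩
      rcases Finset.mem_insert.1 hB with rfl | hB
      · simp
      · exact (h₁ B hB).trans (Finset.subset_insert _ _)
    | some B =>
      have hB := some_mem_outcomes.1 ho
      have hsum := Finset.add_sum_erase F Finset.card hB
      rw [next_some, Finset.sum_insert (insert_notMem_erase hiF B),
        Finset.card_insert_of_notMem (insert_notMem_erase hiF B),
        Finset.card_insert_of_notMem (hiF B hB), Finset.card_erase_add_one hB]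
      refine ⟨fun B' hB' => ?_, by lia, by lia⟩
      rcases Finset.mem_insert.1 hB' with rfl | hB'
      · exact Finset.insert_subset_insert _ (h₁ B hB)
      · exact (h₁ B' (Finset.mem_of_mem_erase hB')).trans (Finset.subset_insert _ _)

lemma notMem_of_reach {A : Finset (Fin n)} {F : Finset (Finset (Fin n))}
    (h : (triangleProcess n q ρ).Reach A F) {i : Fin n} (hi : i ∉ A) : ∀ B ∈ F, i ∉ B :=
  fun B hB h' => hi ((partition_of_reach h).1 B hB h')

section

variable {F : Finset (Finset (Fin n))} {i : Fin n}

lemma erase_join (hi : ∀ B ∈ F, i ∉ B) (B : Finset (Fin n)) {B' : Finset (Fin n)} (hB' : B' ∈ F) :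
    (insert (insert i B) (F.erase B)).erase B' =
      insert (insert i B) ((F.erase B).erase B') :=
  Finset.erase_insert_of_ne fun h => hi B' hB' (h ▸ Finset.mem_insert_self _ _)

lemma erase_new (hi : ∀ B ∈ F, i ∉ B) {B : Finset (Fin n)} (hB : B ∈ F) :
    (insert {i} F).erase B = insert {i} (F.erase B) :=
  Finset.erase_insert_of_ne fun h => hi B hB (h ▸ Finset.mem_singleton_self _)

lemma step_none (hi : ∀ B ∈ F, i ∉ B) (A : Finset (Fin n)) (j : Fin n)
    (φ : Finset (Finset (Fin n)) → ℝ) :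
    (triangleProcess n q ρ).step A (insert {i} F) j φ =
      ∑ B ∈ F, (q - B.card) * φ (insert {i} (insert (insert j B) (F.erase B))) +
      (q - 1) * φ (insert {i, j} F) +
      ((n : ℝ) - F.card * q - q) * φ (insert {i} (insert {j} F)) := by
  rw [step_eq, Finset.sum_insert (singleton_notMem hi),
    Finset.card_insert_of_notMem (singleton_notMem hi), Finset.erase_insert (singleton_notMem hi),
    Finset.card_singleton, Finset.sum_congr rfl fun B hB => by
      rw [erase_new hi hB, Finset.insert_comm], Finset.pair_comm i j,
    Finset.insert_comm ({j} : Finset (Fin n)) {i} F]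
  push_cast
  ring

lemma step_some (hi : ∀ B ∈ F, i ∉ B) {B : Finset (Fin n)} (hB : B ∈ F) (A : Finset (Fin n))
    (j : Fin n) (φ : Finset (Finset (Fin n)) → ℝ) :
    (triangleProcess n q ρ).step A (insert (insert i B) (F.erase B)) j φ =
      ∑ B' ∈ F.erase B, (q - B'.card) *
        φ (insert (insert j B') (insert (insert i B) ((F.erase B).erase B'))) +
      (q - B.card - 1) * φ (insert (insert i (insert j B)) (F.erase B)) +
      ((n : ℝ) - F.card * q) * φ (insert {j} (insert (insert i B) (F.erase B))) := by
  rw [step_eq, Finset.sum_insert (insert_notMem_erase hi B),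
    Finset.card_insert_of_notMem (insert_notMem_erase hi B), Finset.card_erase_add_one hB,
    Finset.erase_insert (insert_notMem_erase hi B), Finset.card_insert_of_notMem (hi B hB),
    Finset.sum_congr rfl fun B' hB' => by rw [erase_join hi B (Finset.mem_of_mem_erase hB')],
    Finset.insert_comm j i]
  push_cast
  ring

/-- Joining a part does not change the number of parts, so the weight `n - |F| q` of a new part
factors out of all mixed terms. The result is symmetric in `i` and `j` up to reordering. -/
lemma step_step (hi : ∀ B ∈ F, i ∉ B) (A A' : Finset (Fin n)) (j : Fin n)
    (φ : Finset (Finset (Fin n)) → ℝ) :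
    (triangleProcess n q ρ).step A F i
        (fun F' => (triangleProcess n q ρ).step A' F' j φ) =
      ∑ B ∈ F, ∑ B' ∈ F.erase B, (q - B.card) * ((q - B'.card) *
        φ (insert (insert j B') (insert (insert i B) ((F.erase B).erase B')))) +
      ∑ B ∈ F, (q - B.card) * ((q - B.card - 1) *
        φ (insert (insert i (insert j B)) (F.erase B))) +
      ((n : ℝ) - F.card * q) *
        (∑ B ∈ F, (q - B.card) * φ (insert {j} (insert (insert i B) (F.erase B))) +
        ∑ B ∈ F, (q - B.card) * φ (insert {i} (insert (insert j B) (F.erase B))) +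
        (q - 1) * φ (insert {i, j} F) +
        ((n : ℝ) - F.card * q - q) * φ (insert {i} (insert {j} F))) := by
  have h : ∀ B ∈ F, (q - B.card) * (triangleProcess n q ρ).step A'
      (insert (insert i B) (F.erase B)) j φ =
      ∑ B' ∈ F.erase B, (q - B.card) * ((q - B'.card) *
        φ (insert (insert j B') (insert (insert i B) ((F.erase B).erase B')))) +
      (q - B.card) * ((q - B.card - 1) * φ (insert (insert i (insert j B)) (F.erase B))) +
      ((n : ℝ) - F.card * q) *
        ((q - B.card) * φ (insert {j} (insert (insert i B) (F.erase B)))) := fun B hB => by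
    rw [step_some hi hB, ← Finset.mul_sum]
    ring
  rw [step_eq, step_none hi, Finset.sum_congr rfl h, Finset.sum_add_distrib,
    Finset.sum_add_distrib, ← Finset.mul_sum]
  ring

end

lemma act_join (σ : Equiv.Perm (Fin n)) (F : Finset (Finset (Fin n))) (i : Fin n)
    (B : Finset (Fin n)) : (triangleProcess n q ρ).act σ (insert (insert i B) (F.erase B)) =
      insert (insert (σ i) (B.map σ.toEmbedding))
        (((triangleProcess n q ρ).act σ F).erase (B.map σ.toEmbedding)) := by
  simp [act_eq, Finset.map_insert, Finset.map_erase, Finset.mapEmbedding_apply]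

lemma act_new (σ : Equiv.Perm (Fin n)) (F : Finset (Finset (Fin n))) (i : Fin n) :
    (triangleProcess n q ρ).act σ (insert {i} F) =
      insert {σ i} ((triangleProcess n q ρ).act σ F) := by
  simp [act_eq, Finset.map_insert, Finset.mapEmbedding_apply]

lemma laws : (triangleProcess n q ρ).Laws where
  sum_weight {A F} hT := by
    simp only [triangleProcess, Finset.sum_insertNone, Finset.sum_sub_distrib, Finset.sum_const,
      nsmul_eq_mul, ← Nat.cast_sum, (partition_of_reach hT).2.1]
    ring
  step_comm {A F} hT {i j} hi hj hij φ := by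
    have hcomm : ∑ B ∈ F, ∑ B' ∈ F.erase B, (q - B.card) * ((q - B'.card) *
          φ (insert (insert j B') (insert (insert i B) ((F.erase B).erase B')))) =
        ∑ B' ∈ F, ∑ B ∈ F.erase B', (q - B'.card) * ((q - B.card) *
          φ (insert (insert i B) (insert (insert j B') ((F.erase B').erase B)))) := by
      refine (Finset.sum_comm' fun v w => ?_).trans
        (Finset.sum_congr rfl fun B' _ => Finset.sum_congr rfl fun B _ => ?_)
      · simp only [Finset.mem_erase]
        tauto
      · rw [Finset.erase_right_comm, Finset.insert_comm (insert j B')]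
        ring
    rw [step_step (notMem_of_reach hT hi), step_step (notMem_of_reach hT hj), Finset.pair_comm i j,
      hcomm]
    simp only [Finset.insert_comm i j, Finset.insert_comm {i} {j}]
    ring
  step_remove {A F} hT {i j} hi hj hij {o} ho φ ψ h := by
    have hiF := notMem_of_reach hT hi
    have hjF := notMem_of_reach hT hj
    have hnn : ψ (insert {i} (insert {j} F)) = φ (insert {j} F) :=
      h none none_mem_outcomes none none_mem_outcomes
    have hnj : ψ (insert {i, j} F) = φ (insert {j} F) := by
      have := h none none_mem_outcomes (some {j})
        (some_mem_outcomes.2 (Finset.mem_insert_self _ _))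
      rwa [next_none, next_some, Finset.erase_insert (singleton_notMem hjF)] at this
    have hns : ∀ B ∈ F, ψ (insert {j} (insert (insert i B) (F.erase B))) =
        φ (insert {j} F) := fun B hB => by
      have := h none none_mem_outcomes (some B)
        (some_mem_outcomes.2 (Finset.mem_insert_of_mem hB))
      rwa [next_none, next_some, erase_new hjF hB, Finset.insert_comm] at this
    have hsn : ∀ B ∈ F, ψ (insert {i} (insert (insert j B) (F.erase B))) =
        φ (insert (insert j B) (F.erase B)) := fun B hB =>
      h (some B) (some_mem_outcomes.2 hB) none none_mem_outcomes
    have hsj : ∀ B ∈ F, ψ (insert (insert i (insert j B)) (F.erase B)) =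
        φ (insert (insert j B) (F.erase B)) := fun B hB => by
      have := h (some B) (some_mem_outcomes.2 hB) (some (insert j B))
        (some_mem_outcomes.2 (Finset.mem_insert_self _ _))
      rwa [next_some, next_some, Finset.erase_insert (insert_notMem_erase hjF B)] at this
    have hss : ∀ B ∈ F, ∀ B' ∈ F.erase B,
        ψ (insert (insert i B') (insert (insert j B) ((F.erase B).erase B'))) =
        φ (insert (insert j B) (F.erase B)) := fun B hB B' hB' => by
      have := h (some B) (some_mem_outcomes.2 hB) (some B')
        (some_mem_outcomes.2 (Finset.mem_insert_of_mem hB'))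
      rwa [next_some, next_some, erase_join hjF B (Finset.mem_of_mem_erase hB')] at this
    cases o with
    -- Forgetting `i`, joining `{i}` and opening a further part are the same for `j`: the weights `q
    -- - 1` and `n - |F| q - q` add up to one less than `n - |F| q`.
    | none =>
      rw [next_none, next_none, step_none hiF, step_eq, hnn, hnj,
        Finset.sum_congr rfl fun B hB => by rw [hsn B hB]]
      ring
    | some B =>
      have hB := some_mem_outcomes.1 ho
      rw [next_some, next_some, step_some hiF hB, step_eq, hns B hB, hsj B hB,
        ← Finset.sum_erase_add _ _ hB, Finset.sum_congr rfl fun B' hB' => ?_]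
      · ring
      · obtain ⟨hne, hB'F⟩ := Finset.mem_erase.1 hB'
        rw [Finset.erase_right_comm, Finset.insert_comm,
          hss B' hB'F B (Finset.mem_erase.2 ⟨hne.symm, hB⟩)]
  step_act {A F} _ {i} _ σ φ := by
    simp only [step_eq, act_join, act_new]
    simp only [act_eq, Finset.card_map, Finset.sum_map]
    congr 1
    refine Finset.sum_congr rfl fun B _ => ?_
    simp [Finset.mapEmbedding_apply]
  act_init σ := rfl
  act_next {A F} hT {i} _ {o} ho σ hσ := by
    have hfix : ∀ B ∈ F, B.map σ.toEmbedding = B := fun B hB =>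
      QueryProcess.map_eq_of_fix fun a ha => hσ a ((partition_of_reach hT).1 B hB ha)
    have h : (triangleProcess n q ρ).act σ F = F := by
      rw [act_eq]
      exact (Finset.eq_of_subset_of_card_le
        (fun B hB => Finset.mem_map.2 ⟨B, hB, hfix B hB⟩) (by simp)).symm
    cases o with
    | none => rw [next_none, next_none, act_new, h]
    | some B => rw [next_some, next_some, act_join, h, hfix B (some_mem_outcomes.1 ho)]
  val_next {A F} hT {i} hi {o} ho e he := by
    have hie : i ∉ e.1 := fun h => hi (he h)
    have hcard : e.1.card = 2 := Finset.mem_powersetCard_univ.1 e.2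
    have hiff : (∃ B ∈ (triangleProcess n q ρ).next F i o, e.1 ⊆ B) ↔ ∃ B ∈ F, e.1 ⊆ B := by
      cases o with
      | none =>
        have : ¬e.1 ⊆ {i} := fun h => by simpa [hcard] using Finset.card_le_card h
        rw [next_none, Finset.exists_mem_insert, or_iff_right this]
      | some B =>
        have hB := some_mem_outcomes.1 ho
        rw [next_some, Finset.exists_mem_insert, Finset.subset_insert_iff_of_notMem hie,
          ← Finset.exists_mem_insert, Finset.insert_erase hB]
    exact if_congr hiff rfl rfl
  val_act σ F e := by
    have hiff : (∃ B ∈ (triangleProcess n q ρ).act σ F, e.1.map σ.toEmbedding ⊆ B) ↔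
        ∃ B ∈ F, e.1 ⊆ B := by
      simp [act_eq, Finset.mapEmbedding_apply]
    exact if_congr hiff rfl rfl

lemma realizes {k : ℝ} (hk : 1 ≤ k) (d : ℕ) :
    ∀ (A : List (Fin n)) (F : Finset (Finset (Fin n))),
      (triangleProcess n (n / k) ρ).Reach A.toFinset F → A.Nodup →
      (triangleProcess n (n / k) ρ).Realizes (⌊min k ((n : ℝ) / k)⌋₊ + 1)
        (triangleStoryFrom n k ρ d A F) F := by
  induction d with
  | zero => exact fun _ _ _ _ => rfl
  | succ d ih =>
    intro A F hT hn
    have hcard : A.toFinset.card = A.length := List.toFinset_card_of_nodup hn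
    have hmem : ∀ o : Option F,
        o.map Subtype.val ∈ (triangleProcess n (n / k) ρ).outcomes A.toFinset F := fun o =>
      match o with
      | none => none_mem_outcomes
      | some B => some_mem_outcomes.2 B.2
    obtain ⟨h₁, -, h₃⟩ := partition_of_reach hT
    refine ⟨rfl, fun i hi => ⟨Option.map Subtype.val, hmem, fun o ho => ?_, fun o => ?_,
      fun φ => ?_⟩⟩
    · have hk0 : 0 < k := by linarith
      have hq0 : 0 ≤ (n : ℝ) / k := by positivity
      -- As `|F| ≤ |A| ≤ k`, the parts present require at most `n` vertices in all, and `|B| ≤ |A| ≤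
      -- n / k` leaves room in each part.
      have hfl : (A.length : ℝ) ≤ min k ((n : ℝ) / k) :=
        (Nat.cast_le.2 (show A.length ≤ ⌊min k ((n : ℝ) / k)⌋₊ by lia)).trans
          (Nat.floor_le (le_min hk0.le hq0))
      have hAk := hfl.trans (min_le_left _ _)
      have hAq := hfl.trans (min_le_right _ _)
      have hA : (0 : ℝ) ≤ (n : ℝ) - A.length := by
        have : A.length ≤ n := by
          rw [← hcard]; simpa using A.toFinset.card_le_univ
        have : (A.length : ℝ) ≤ n := by exact_mod_cast this
        linarith
      cases o with
      | none =>
        refine div_nonneg ?_ hA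
        have hF : (F.card : ℝ) ≤ k := by
          refine le_trans ?_ hAk
          rw [← hcard]; exact_mod_cast h₃
        have := mul_le_mul_of_nonneg_right hF hq0
        rw [mul_div_cancel₀ _ hk0.ne'] at this
        linarith
      | some B =>
        refine div_nonneg ?_ hA
        have : (B.1.card : ℝ) ≤ A.length := by
          rw [← hcard]; exact_mod_cast Finset.card_le_card (h₁ B.1 B.2)
        linarith
    · have hreach := hT.step (by simpa using hi) (hmem o)
      rw [← QueryProcess.toFinset_append_singleton] at hreach
      have hnd : (A ++ [i]).Nodup := by
        simp [List.nodup_append, hn]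
        exact fun a ha h => hi (h ▸ ha)
      cases o with
      | none => exact ih _ _ hreach hnd
      | some B => exact ih _ _ hreach hnd
    · have h := Finset.sum_coe_sort F fun B =>
        ((n : ℝ) / k - B.card) / ((n : ℝ) - A.length) * φ (some B)
      simp only [triangleProcess, Finset.sum_insertNone, hcard, Fintype.sum_option,
        Option.map_some, Option.map_none, h]
      rw [add_div, Finset.sum_div]
      congr 1
      · ring
      · exact Finset.sum_congr rfl fun B _ => by ring

/-! ### Expected numbers of edges and triangles -/

section Expectations

lemma ev_empty (hn : 0 < n) (i : Fin n) (f : (triangleProblem n ρ).Poly) :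
    (triangleProcess n q ρ).ev ∅ ∅ f = (triangleProcess n q ρ).ev {i} {{i}} f := by
  have hn' : (n : ℝ) ≠ 0 := by positivity
  have hT : (triangleProcess n q ρ).Reach ∅ ∅ := .init
  rw [laws.ev_step hT (Finset.notMem_empty i), step_eq]
  simp [hn']

lemma reach_single (i : Fin n) : (triangleProcess n q ρ).Reach {i} {{i}} :=
  QueryProcess.Reach.step (Q := triangleProcess n q ρ) (o := none) .init (Finset.notMem_empty i)
    none_mem_outcomes

lemma reach_pair {i j : Fin n} (hij : i ≠ j) :
    (triangleProcess n q ρ).Reach {i, j} {{i}, {j}} :=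
  (reach_single j).step (o := none) (by simpa using hij) none_mem_outcomes

lemma reach_pair' {i j : Fin n} (hij : i ≠ j) :
    (triangleProcess n q ρ).Reach {i, j} {{i, j}} := by
  have := (reach_single (q := q) (ρ := ρ) j).step (i := i) (o := some {j}) (by simpa using hij)
    (some_mem_outcomes.2 (by simp))
  simpa [next_some] using this

lemma ev_single {i j : Fin n} (hij : i ≠ j) (f : (triangleProblem n ρ).Poly) :
    (triangleProcess n q ρ).ev {j} {{j}} f =
      ((q - 1) * (triangleProcess n q ρ).ev {i, j} {{i, j}} f +
      ((n : ℝ) - q) * (triangleProcess n q ρ).ev {i, j} {{i}, {j}} f) / ((n : ℝ) - 1) := by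
  rw [laws.ev_step (reach_single j) (i := i) (by simpa using hij), step_eq]
  simp

/-- The polynomial `∏ x_e` over the edges inside `T`. -/
noncomputable def edgeProd (n : ℕ) (ρ : ℝ) (T : Finset (Fin n)) : (triangleProblem n ρ).Poly :=
  ∏ e : (triangleProblem n ρ).edges with e.1 ⊆ T, X e

lemma edgeProd_mem_polysOn (T : Finset (Fin n)) :
    edgeProd n ρ T ∈ (triangleProblem n ρ).polysOn T :=
  Subalgebra.prod_mem _ fun _ he => X_mem_polysOn (Finset.mem_filter.1 he).2

/-- The variable of the pair inside `B` is already known to be 0 and can be pulled out, even if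
other vertices of `T` are unrevealed. -/
lemma ev_edgeProd_eq_zero {A : Finset (Fin n)} {F : Finset (Finset (Fin n))}
    (hT : (triangleProcess n q ρ).Reach A F) {i j : Fin n} (hij : i ≠ j) {T B : Finset (Fin n)}
    (hB : B ∈ F) (hiB : i ∈ B) (hjB : j ∈ B) (hi : i ∈ T) (hj : j ∈ T) :
    (triangleProcess n q ρ).ev A F (edgeProd n ρ T) = 0 := by
  let e : (triangleProblem n ρ).edges :=
    ⟨{i, j}, Finset.mem_powersetCard_univ.2 (Finset.card_pair hij)⟩
  have heB : e.1 ⊆ B := by simp [e, Finset.insert_subset_iff, hiB, hjB]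
  have heT : e ∈ Finset.univ.filter fun e : (triangleProblem n ρ).edges => e.1 ⊆ T := by
    simp [e, Finset.insert_subset_iff, hi, hj]
  rw [edgeProd, ← Finset.mul_prod_erase _ _ heT, laws.ev_mul_left hT _ _
    (X_mem_polysOn (heB.trans ((partition_of_reach hT).1 B hB))), aeval_X]
  have : (triangleProcess n q ρ).val F e = 0 := if_pos ⟨B, hB, heB⟩
  rw [this, zero_mul]

lemma ev_edgeProd_eq_one {A : Finset (Fin n)} {F : Finset (Finset (Fin n))}
    (hT : (triangleProcess n q ρ).Reach A F) (hF : ∀ B ∈ F, B.card ≤ 1) {T : Finset (Fin n)}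
    (hTA : T ⊆ A) : (triangleProcess n q ρ).ev A F (edgeProd n ρ T) = 1 := by
  rw [laws.ev_of_mem_polysOn hT (polysOn_mono _ hTA (edgeProd_mem_polysOn T)), edgeProd, map_prod]
  refine Finset.prod_eq_one fun e _ => ?_
  rw [aeval_X]
  refine if_neg ?_
  rintro ⟨B, hB, heB⟩
  have h := (Finset.card_le_card heB).trans (hF B hB)
  rw [Finset.mem_powersetCard_univ.1 e.2] at h
  lia

lemma ev_edgeProd_two {T : Finset (Fin n)} (hT : T.card = 2) :
    (triangleProcess n q ρ).ev ∅ ∅ (edgeProd n ρ T) = ((n : ℝ) - q) / ((n : ℝ) - 1) := by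
  obtain ⟨i, j, hij, rfl⟩ := Finset.card_eq_two.1 hT
  rw [ev_empty (Fin.pos j) j, ev_single hij,
    ev_edgeProd_eq_zero (reach_pair' hij) hij (B := {i, j}) (by simp) (by simp) (by simp) (by simp)
      (by simp),
    ev_edgeProd_eq_one (reach_pair hij) (by simp) le_rfl]
  ring

/-- Only three distinct parts contribute: the second vertex opens a new part with probability `(n -
q) / (n - 1)` and the third with probability `(n - 2q) / (n - 2)`. -/
lemma ev_edgeProd_three {T : Finset (Fin n)} (hT : T.card = 3) :
    (triangleProcess n q ρ).ev ∅ ∅ (edgeProd n ρ T) =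
      ((n : ℝ) - q) * ((n : ℝ) - 2 * q) / (((n : ℝ) - 1) * ((n : ℝ) - 2)) := by
  obtain ⟨l, i, j, hli, hlj, hij, rfl⟩ := Finset.card_eq_three.1 hT
  have hl : l ∉ ({i, j} : Finset (Fin n)) := by simp [hli, hlj]
  have hpair := reach_pair (q := q) (ρ := ρ) hij
  rw [ev_empty (Fin.pos j) j, ev_single hij,
    ev_edgeProd_eq_zero (reach_pair' hij) hij (B := {i, j}) (by simp) (by simp) (by simp) (by simp)
      (by simp), laws.ev_step hpair hl, step_eq, Finset.sum_eq_zero]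
  · have hone := ev_edgeProd_eq_one (hpair.step hl none_mem_outcomes)
      (by simp [next_none]) (le_refl ({l, i, j} : Finset (Fin n)))
    rw [next_none] at hone
    rw [hone, Finset.card_pair (by simpa using hij), Finset.card_pair hij]
    push_cast
    rw [mul_zero, zero_add, zero_add, mul_one, mul_div_assoc', div_div, mul_comm ((n : ℝ) - 2)]
  · intro B hB
    have hzero : ∀ m, l ≠ m → m ∈ B → m ∈ ({l, i, j} : Finset (Fin n)) →
        (triangleProcess n q ρ).ev {l, i, j} (insert (insert l B) (({{i}, {j}} : Finset _).erase B))
          (edgeProd n ρ {l, i, j}) = 0 := fun m hlm hmB hm =>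
      ev_edgeProd_eq_zero (hpair.step hl (some_mem_outcomes.2 hB)) hlm
        (Finset.mem_insert_self _ _) (Finset.mem_insert_self l B) (Finset.mem_insert_of_mem hmB)
        (by simp) hm
    rcases Finset.mem_insert.1 hB with rfl | hB'
    · rw [hzero i hli (by simp) (by simp), mul_zero]
    · obtain rfl := Finset.mem_singleton.1 hB'
      rw [hzero j hlj (by simp) (by simp), mul_zero]

end Expectations

/-! ### The edge density and Goodman's bound -/

section Equations

/-- The monomial `∏ x_e` over the edges inside `T`. -/
noncomputable def edgeMonomial (n : ℕ) (ρ : ℝ) (T : Finset (Fin n)) :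
    (triangleProblem n ρ).edges →₀ ℕ :=
  ∑ e : (triangleProblem n ρ).edges with e.1 ⊆ T, Finsupp.single e 1

lemma edgeProd_eq_monomial (T : Finset (Fin n)) :
    edgeProd n ρ T = monomial (edgeMonomial n ρ T) 1 := by
  rw [edgeMonomial, monomial_sum_one]
  rfl

lemma subset_indices_edgeMonomial {T : Finset (Fin n)} (hT : 2 ≤ T.card) :
    T ⊆ (triangleProblem n ρ).indices (edgeMonomial n ρ T) := by
  intro v hv
  obtain ⟨w, hw, hwv⟩ := Finset.exists_mem_ne (s := T) (by lia) v
  let e : (triangleProblem n ρ).edges :=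
    ⟨{v, w}, Finset.mem_powersetCard_univ.2 (Finset.card_pair hwv.symm)⟩
  refine Finset.mem_biUnion.2 ⟨e, ?_, by simp [e]⟩
  have heT : e.1 ⊆ T := by simp [e, Finset.insert_subset_iff, hv, hw]
  simp [edgeMonomial, Finsupp.finsetSum_apply, Finsupp.single_apply, heT]

/-- The sum of `∏ x_e` over all sets of `t` vertices, minus a constant. -/
noncomputable def cliqueEq (n : ℕ) (ρ : ℝ) (t : ℕ) (c : ℝ) : (triangleProblem n ρ).Poly :=
  ∑ T ∈ tSubsets n t, edgeProd n ρ T - C c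

lemma edgeProd_edge (e : (triangleProblem n ρ).edges) : edgeProd n ρ e.1 = X e := by
  have h : (Finset.univ.filter fun e' : (triangleProblem n ρ).edges => e'.1 ⊆ e.1) = {e} := by
    ext e'
    simp only [Finset.mem_filter, Finset.mem_univ, true_and, Finset.mem_singleton]
    refine ⟨fun h => Subtype.ext (Finset.eq_of_subset_of_card_le h ?_), fun h => h ▸ le_rfl⟩
    rw [Finset.mem_powersetCard_univ.1 e.2, Finset.mem_powersetCard_univ.1 e'.2]
  rw [edgeProd, h, Finset.prod_singleton]

lemma eqs_cases {s : (triangleProblem n ρ).Poly} (hs : s ∈ (triangleProblem n ρ).eqs) :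
    (∃ e : (triangleProblem n ρ).edges, s = X e ^ 2 - X e) ∨
      s = cliqueEq n ρ 2 (ρ * (n.choose 2 : ℝ)) ∨ s = cliqueEq n ρ 3 (goodmanBound n ρ) := by
  obtain h | h | h := hs
  · exact Or.inl h
  · refine Or.inr (Or.inl (Eq.trans h ?_))
    rw [cliqueEq]
    congr 1
    exact (Finset.sum_congr rfl fun e _ => (edgeProd_edge e).symm).trans
      (Finset.sum_coe_sort (tSubsets n 2) (edgeProd n ρ))
  · exact Or.inr (Or.inr h)

lemma isSymmetricOutside_cliqueEq (A : Finset (Fin n)) (t : ℕ) (c : ℝ) :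
    (triangleProblem n ρ).IsSymmetricOutside A (cliqueEq n ρ t c) := by
  intro σ _
  simp only [permPoly, cliqueEq, edgeProd, map_sub, map_sum, map_prod, rename_X, rename_C]
  congr 1
  refine Finset.sum_bij (fun T _ => T.map σ.toEmbedding)
    (fun T hT => map_mem_tSubsets σ T hT) (fun T _ T' _ h => Finset.map_injective _ h)
    (fun T hT => ⟨T.map σ.symm.toEmbedding, map_mem_tSubsets σ.symm T hT, by ext; simp⟩)
    (fun T _ => ?_)
  refine Finset.prod_equiv (permSubsets σ) (fun e => ?_) (fun e _ => rfl)
  simp only [Finset.mem_filter, Finset.mem_univ, true_and]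
  exact Finset.map_subset_map.symm

lemma indexDeg_cliqueEq_le (A : Finset (Fin n)) (t : ℕ) (c : ℝ) :
    (triangleProblem n ρ).indexDeg A (cliqueEq n ρ t c) ≤ t := by
  refine Submodule.sub_mem ((triangleProblem n ρ).lowIndexDeg A t)
    (Submodule.sum_mem _ fun T hT => ?_) (C_mem_lowIndexDeg _ _ _)
  exact mem_lowIndexDeg_of_mem_polysOn (edgeProd_mem_polysOn T) _
    (Finset.mem_powersetCard_univ.1 hT).le

/-- There is room for a `t`-set disjoint from `A`. Its monomial cannot cancel because all summands
have nonnegative coefficients and the constant term is a different monomial. -/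
lemma le_indexDeg_cliqueEq {A : Finset (Fin n)} {t : ℕ} (ht : 2 ≤ t) (hA : A.card + t ≤ n)
    (c : ℝ) : t ≤ (triangleProblem n ρ).indexDeg A (cliqueEq n ρ t c) := by
  obtain ⟨T, hTA, hT⟩ := Finset.exists_subset_card_eq (s := Aᶜ) (n := t)
    (by rw [Finset.card_compl, Fintype.card_fin]; lia)
  have hsub := subset_indices_edgeMonomial (ρ := ρ) (ht.trans hT.ge)
  have hne : edgeMonomial n ρ T ≠ 0 := by
    intro h
    rw [h] at hsub
    have : T = ∅ := by simpa [indices] using hsub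
    simp [this] at hT
    lia
  have hcoeff : coeff (edgeMonomial n ρ T) (cliqueEq n ρ t c) ≠ 0 := by
    rw [cliqueEq, coeff_sub, coeff_sum, coeff_C, if_neg hne.symm, sub_zero]
    refine (Finset.sum_pos' (fun T' _ => ?_) ⟨T, Finset.mem_powersetCard_univ.2 hT, ?_⟩).ne'
    · rw [edgeProd_eq_monomial, coeff_monomial]
      split_ifs <;> norm_num
    · rw [edgeProd_eq_monomial, coeff_monomial, if_pos rfl]
      exact one_pos
  refine le_trans ?_ (le_indexDeg hcoeff A)
  rw [← hT]
  refine Finset.card_le_card fun v hv => Finset.mem_sdiff.2 ⟨hsub hv, ?_⟩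
  exact Finset.mem_compl.1 (hTA hv)

lemma ev_cliqueEq {t : ℕ} {c E : ℝ}
    (hE : ∀ T ∈ tSubsets n t, (triangleProcess n q ρ).ev ∅ ∅ (edgeProd n ρ T) = E) :
    (triangleProcess n q ρ).ev ∅ ∅ (cliqueEq n ρ t c) = n.choose t * E - c := by
  have hT : (triangleProcess n q ρ).Reach ∅ ∅ := .init
  rw [cliqueEq, laws.ev_sub hT, laws.ev_sum hT, laws.ev_C hT, Finset.sum_congr rfl hE]
  simp

/-- With three vertices outside `A`, the index degrees of the two counting equations on `[n] \ A`
are as large as on all of `[n]`, so `ev_eq_init` reduces to the initial state. There the relation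
between `q` and `ρ` says that `ρ = (n - q) / (n - 1)`, and Goodman's bound is the resulting expected
number of triangles. -/
lemma satisfiesEqs {R : ℕ} (hR : R + 3 ≤ n) (hq : q - 1 = (1 - ρ) * ((n : ℝ) - 1)) :
    (triangleProcess n q ρ).SatisfiesEqs R := by
  have hn : (3 : ℝ) ≤ n := by exact_mod_cast (show 3 ≤ n by lia)
  have h1 : (n : ℝ) - 1 ≠ 0 := by linarith
  have h2 : (n : ℝ) - 2 ≠ 0 := by linarith
  intro A hA s hs A' F hT hAA' hd
  have key : ∀ (t : ℕ) (c : ℝ), 2 ≤ t → t ≤ 3 →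
      A'.card + (triangleProblem n ρ).indexDeg A (cliqueEq n ρ t c) ≤ n →
      (triangleProcess n q ρ).ev A' F (cliqueEq n ρ t c) =
        (triangleProcess n q ρ).ev ∅ ∅ (cliqueEq n ρ t c) := fun t c h2 h3 hd => by
    have hle := le_indexDeg_cliqueEq (ρ := ρ) (A := A) h2 (by lia) c
    have hge := indexDeg_cliqueEq_le (ρ := ρ) (∅ : Finset (Fin n)) t c
    exact laws.ev_eq_init (isSymmetricOutside_cliqueEq ∅ t c) hT (by lia)
  rcases eqs_cases hs with ⟨e, rfl⟩ | rfl | rfl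
  · exact laws.ev_X_sq_sub_X (fun T e => ite_eq_or_eq _ _ _) hT e
  · rw [key 2 _ le_rfl (by lia) hd,
      ev_cliqueEq fun T hT => ev_edgeProd_two (Finset.mem_powersetCard_univ.1 hT)]
    field_simp
    linear_combination (-(n.choose 2 : ℝ)) * hq
  · have hchoose : (n.choose 3 : ℝ) * 6 = n * ((n : ℝ) - 1) * ((n : ℝ) - 2) := by
      have h := Nat.choose_succ_right_eq n 2
      have h' : (n.choose 3 : ℝ) * 3 = n.choose 2 * ((n : ℝ) - 2) := by
        have : ((n - 2 : ℕ) : ℝ) = (n : ℝ) - 2 := by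
          rw [Nat.cast_sub (by lia)]; norm_num
        rw [← this]
        exact_mod_cast h
      rw [Nat.cast_choose_two] at h'
      linear_combination 2 * h'
    have hρ : ρ = ((n : ℝ) - q) / ((n : ℝ) - 1) := by
      field_simp
      linear_combination hq
    have hchoose' : (n.choose 3 : ℝ) = n * ((n : ℝ) - 1) * ((n : ℝ) - 2) / 6 := by
      linear_combination hchoose / 6
    rw [key 3 _ (by lia) le_rfl hd,
      ev_cliqueEq fun T hT => ev_edgeProd_three (Finset.mem_powersetCard_univ.1 hT), goodmanBound,
      hchoose', hρ]
    field_simp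
    ring

end Equations

end triangleProcess

theorem triangleStory_isGoodStory {n : ℕ} {k ρ : ℝ} (hn : 6 ≤ n) (hk : 1 ≤ k)
    (hρ : (n : ℝ) / k - 1 = (1 - ρ) * ((n : ℝ) - 1)) :
    Strategy.IsGoodStory (⌊min k ((n : ℝ) / k)⌋₊ + 1) n (triangleStory n k ρ) := by
  have hlt : ⌊min k ((n : ℝ) / k)⌋₊ + 1 + 3 ≤ n := by
    have hk0 : 0 < k := by linarith
    have hq0 : 0 ≤ (n : ℝ) / k := by positivity
    have hfl := Nat.floor_le (le_min hk0.le hq0)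
    set s := ⌊min k ((n : ℝ) / k)⌋₊
    -- The floor `s` satisfies `s * s ≤ k * (n / k) = n`. If `n ≤ s + 3`, then `s ≤ 2` and `n ≤ 5`,
    -- so `6 ≤ n` is what is needed.
    have hs : (s : ℝ) * s ≤ n := by
      calc (s : ℝ) * s ≤ k * (n / k) := mul_le_mul (hfl.trans (min_le_left _ _))
            (hfl.trans (min_le_right _ _)) (Nat.cast_nonneg _) hk0.le
        _ = n := mul_div_cancel₀ _ hk0.ne'
    have hs' : s * s ≤ n := by exact_mod_cast hs
    by_contra! h
    nlinarith
  exact triangleProcess.laws.isGoodStory (triangleProcess.satisfiesEqs hlt hρ) _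
    (triangleProcess.realizes hk n [] ∅ .init List.nodup_nil) .init List.nodup_nil (by simp)
    (by simp)

theorem mainTheorem5 :
    (∀ (n : ℕ) (k : ℝ), 2 ≤ n → 0 ≤ k → k ≤ n → ¬(n = 2 ∧ k = 1) →
      Strategy.IsGoodStory (⌊min k ((n : ℝ) - k)⌋₊ + 1) n (knapsackStory n k)) ∧
    (∀ n : ℕ, 5 ≤ n →
      Strategy.IsGoodStory (n / 2 + 1) n (modTwoStory n)) ∧
    (∀ (n : ℕ) (k ρ : ℝ), 6 ≤ n → 1 ≤ k → k ≤ n →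
      (n : ℝ) / k - 1 = (1 - ρ) * ((n : ℝ) - 1) →
      Strategy.IsGoodStory (⌊min k ((n : ℝ) / k)⌋₊ + 1) n (triangleStory n k ρ)) := by
  exact ⟨fun _ _ hn hk hkn hnk => knapsackStory_isGoodStory hn hk hkn hnk,
    fun _ hn => modTwoStory_isGoodStory hn,
    fun _ _ _ hn hk _ hρ => triangleStory_isGoodStory hn hk hρ⟩
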